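/- Let $S=\{1,\dots,n\}$, let $A_i,B_i$ ($i\in S$) be nonempty finite sets (the actions of player MIN and of player MAX in state $i$), and for $i\in S$, $a\in A_i$, $b\in B_i$ let $P_i^{ab}$ be a probability vector on $S$. The associated payment-free Shapley operator $F:\mathbb{R}^n\to\mathbb{R}^n$ is $$[F(x)]_i=\min_{a\in A_i}\max_{b\in B_i}\sum_{j\in S}(P_i^{ab})_j\,x_j,\qquad i\in S.$$ Let $m_2=\sum_{i\in S}|A_i||B_i|$ be the number of triples $(i,a,b)$, let $m$ be the greatest cardinality of the sets $A_i$, $B_i$, and let $\widetilde F(x)=-F(-x)$ be the conjugate operator. For $u\in\mathbb{R}^n$ let $\operatorname{argmin}u$ and $\operatorname{argmax}u$ be the sets of indices of the minimal and of the maximal entries of $u$. Consider the problem IMinJMax: given $F$ (through $n$, the action sets and $P$) and nonempty disjoint subsets $I,J\subset S$, decide whether $F$ has a fixed point $u$ with $\operatorname{argmin}u=I$ and $\operatorname{argmax}u=J$. Then: 1. IMinJMax can be solved in $O(n^2m_2)$ time: there are a program for a random access machine with unit cost and a constant $C$ such that, for every input, the program halts after at most $C\,n^2m_2$ steps with the right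 answer. Here the machine may increment, decrement, copy and compare natural numbers, access arrays by indirect addressing, and read the input tables, one entry at a time; the entries $(P_i^{ab})_j$ are real numbers, which it can only test for positivity. Moreover $n^2m_2\le n^3m^2$, so that the time is also $O(n^3m^2)$. 2. $\widetilde F$ is again a payment-free Shapley operator on $\mathbb{R}^n$ with finite action spaces, and, for nonempty disjoint $I,J\subset S$, the answer to IMinJMax is positive if and only if $F$ has a fixed point whose argmin is $I$ and $\widetilde F$ has a fixed point whose argmin is $J$. -/

import Mathlib

namespace PaymentFree

/-! ### Games, payment-free Shapley operators, fixed points -/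

/-- The data of a payment-free two-player zero-sum game with perfect information on the state
space `Fin n`, with nonempty finite action spaces `Fin (numA i)` (player MIN) and `Fin (numB i)`
(player MAX); `prob i a b` is the transition probability (a probability vector on the states). -/
structure Game (n : ℕ) where
  numA : Fin n → ℕ
  numB : Fin n → ℕ
  numA_pos : ∀ i, 0 < numA i
  numB_pos : ∀ i, 0 < numB i
  prob : (i : Fin n) → Fin (numA i) → Fin (numB i) → Fin n → ℝ
  prob_nonneg : ∀ i a b j, 0 ≤ prob i a b j
  prob_sum : ∀ i a b, ∑ j, prob i a b j = 1

/-- The payment-free Shapley operator `[F x]_i = inf_a sup_b P_i^{ab} x`. The infimum and the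
supremum are over nonempty finite sets. -/
noncomputable def Game.shapley {n : ℕ} (G : Game n) (x : Fin n → ℝ) : Fin n → ℝ :=
  fun i => ⨅ a : Fin (G.numA i), ⨆ b : Fin (G.numB i), ∑ j, G.prob i a b j * x j

/-- The number of triples `(i, a, b)` with `a` an action of MIN and `b` an action of MAX in
state `i`. -/
def Game.m₂ {n : ℕ} (G : Game n) : ℕ := ∑ i, G.numA i * G.numB i

/-- The greatest cardinality of an action space. -/
def Game.maxActions {n : ℕ} (G : Game n) : ℕ :=
  Finset.univ.sup fun i => max (G.numA i) (G.numB i)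

/-- The conjugate operator `x ↦ -F (-x)`. -/
def conjugate {n : ℕ} (F : (Fin n → ℝ) → (Fin n → ℝ)) (x : Fin n → ℝ) : Fin n → ℝ :=
  -F (-x)

def argmin {n : ℕ} (u : Fin n → ℝ) : Set (Fin n) := {i | ∀ j, u i ≤ u j}

def argmax {n : ℕ} (u : Fin n → ℝ) : Set (Fin n) := {i | ∀ j, u j ≤ u i}

/-- `F` has a fixed point whose argmin is `I`. -/
def IMin {n : ℕ} (F : (Fin n → ℝ) → (Fin n → ℝ)) (I : Finset (Fin n)) : Prop :=
  ∃ u : Fin n → ℝ, F u = u ∧ argmin u = (I : Set (Fin n))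

/-- `F` has a fixed point whose argmin is `I` and whose argmax is `J`. -/
def IMinJMax {n : ℕ} (F : (Fin n → ℝ) → (Fin n → ℝ)) (I J : Finset (Fin n)) : Prop :=
  ∃ u : Fin n → ℝ, F u = u ∧ argmin u = (I : Set (Fin n)) ∧ argmax u = (J : Set (Fin n))

/-! ### The machine model

A unit-cost successor random access machine with structured control flow. Its memory consists
of registers `0, 1, 2, …` and of arrays `0, 1, 2, …`, all holding natural numbers. The names of
the registers and arrays are fixed in the program text; array cells are addressed by register
contents. The only arithmetic is adding or subtracting one, so that no operation acts on numbers
larger than those the machine has counted up to or read. The input (the number of states, the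
sizes of the action spaces, the transition probabilities, and the two sets of states) is held in
read-only tables; one entry is accessed at a time, and a transition probability, which is a real
number, can only be tested for positivity. -/

/-- The tests of the machine; the arguments are names of registers. -/
inductive Test where
  /-- register `x` is less than register `y` -/
  | lt (x y : ℕ)
  /-- registers `x` and `y` are equal -/
  | eq (x y : ℕ)
  /-- the state whose number is in register `x` belongs to the first input set `I` -/
  | memI (x : ℕ)
  /-- the state whose number is in register `x` belongs to the second input set `J` -/
  | memJ (x : ℕ)
  /-- the probability of moving from the state in register `i` to the state in register `j`,
  under the actions in registers `a` and `b`, is positive -/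
  | pos (i a b j : ℕ)

/-- Programs. -/
inductive Prog where
  | skip
  /-- register `x` becomes the constant `c` -/
  | const (x c : ℕ)
  /-- register `x` becomes the content of register `y` -/
  | copy (x y : ℕ)
  /-- register `x` is incremented -/
  | succ (x : ℕ)
  /-- register `x` is decremented, unless it is zero -/
  | pred (x : ℕ)
  /-- register `x` becomes the content of the cell of array `k` addressed by register `y` -/
  | load (x k y : ℕ)
  /-- the cell of array `k` addressed by register `x` becomes the content of register `y` -/
  | store (k x y : ℕ)
  /-- register `x` becomes the number of states -/
  | readN (x : ℕ)
  /-- register `x` becomes the number of actions of MIN in the state in register `y` -/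
  | readA (x y : ℕ)
  /-- register `x` becomes the number of actions of MAX in the state in register `y` -/
  | readB (x y : ℕ)
  /-- sequential composition -/
  | seq (p q : Prog)
  /-- if `c` then `p` else `q` -/
  | branch (c : Test) (p q : Prog)
  /-- while `c` do `p` -/
  | loop (c : Test) (p : Prog)

/-- The contents of the memory. -/
structure Memory where
  reg : ℕ → ℕ
  arr : ℕ → ℕ → ℕ

/-- The memory at the start: all zero. -/
def Memory.blank : Memory := ⟨fun _ => 0, fun _ _ => 0⟩

/-- Writing the value `v` in register `x`. -/
def Memory.setReg (s : Memory) (x v : ℕ) : Memory :=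
  ⟨Function.update s.reg x v, s.arr⟩

/-- Writing the value `v` in cell `c` of array `k`. -/
def Memory.setArr (s : Memory) (k c v : ℕ) : Memory :=
  ⟨s.reg, Function.update s.arr k (Function.update (s.arr k) c v)⟩

/-- Entry `y` of a table indexed by the states; `0` if there is no such entry. -/
def lookup {n : ℕ} (f : Fin n → ℕ) (y : ℕ) : ℕ := if h : y < n then f ⟨y, h⟩ else 0

/-- The truth of a test, for the input `G, I, J` and the memory `s`. -/
def Test.Holds {n : ℕ} (G : Game n) (I J : Finset (Fin n)) (s : Memory) : Test → Prop
  | .lt x y => s.reg x < s.reg y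
  | .eq x y => s.reg x = s.reg y
  | .memI x => ∃ i ∈ I, (i : ℕ) = s.reg x
  | .memJ x => ∃ i ∈ J, (i : ℕ) = s.reg x
  | .pos i a b j =>
      ∃ (i' : Fin n) (a' : Fin (G.numA i')) (b' : Fin (G.numB i')) (j' : Fin n),
        (i' : ℕ) = s.reg i ∧ (a' : ℕ) = s.reg a ∧ (b' : ℕ) = s.reg b ∧ (j' : ℕ) = s.reg j ∧
          0 < G.prob i' a' b' j'

/-- `Exec G I J p s t s'`: on input `G, I, J`, the program `p` started with memory `s` halts
after exactly `t` steps with memory `s'`. Every elementary command takes one step, and so does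
every evaluation of a test. -/
inductive Exec {n : ℕ} (G : Game n) (I J : Finset (Fin n)) :
    Prog → Memory → ℕ → Memory → Prop
  | skip (s : Memory) : Exec G I J .skip s 1 s
  | const (x c : ℕ) (s : Memory) : Exec G I J (.const x c) s 1 (s.setReg x c)
  | copy (x y : ℕ) (s : Memory) : Exec G I J (.copy x y) s 1 (s.setReg x (s.reg y))
  | succ (x : ℕ) (s : Memory) : Exec G I J (.succ x) s 1 (s.setReg x (s.reg x + 1))
  | pred (x : ℕ) (s : Memory) : Exec G I J (.pred x) s 1 (s.setReg x (s.reg x - 1))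
  | load (x k y : ℕ) (s : Memory) :
      Exec G I J (.load x k y) s 1 (s.setReg x (s.arr k (s.reg y)))
  | store (k x y : ℕ) (s : Memory) :
      Exec G I J (.store k x y) s 1 (s.setArr k (s.reg x) (s.reg y))
  | readN (x : ℕ) (s : Memory) : Exec G I J (.readN x) s 1 (s.setReg x n)
  | readA (x y : ℕ) (s : Memory) :
      Exec G I J (.readA x y) s 1 (s.setReg x (lookup G.numA (s.reg y)))
  | readB (x y : ℕ) (s : Memory) :
      Exec G I J (.readB x y) s 1 (s.setReg x (lookup G.numB (s.reg y)))
  | seq {p q : Prog} {s s' s'' : Memory} {t t' : ℕ} :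
      Exec G I J p s t s' → Exec G I J q s' t' s'' → Exec G I J (.seq p q) s (t + t') s''
  | branch_true {c : Test} {p q : Prog} {s s' : Memory} {t : ℕ} :
      c.Holds G I J s → Exec G I J p s t s' → Exec G I J (.branch c p q) s (t + 1) s'
  | branch_false {c : Test} {p q : Prog} {s s' : Memory} {t : ℕ} :
      ¬ c.Holds G I J s → Exec G I J q s t s' → Exec G I J (.branch c p q) s (t + 1) s'
  | loop_true {c : Test} {p : Prog} {s s' s'' : Memory} {t t' : ℕ} :
      c.Holds G I J s → Exec G I J p s t s' → Exec G I J (.loop c p) s' t' s'' →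
        Exec G I J (.loop c p) s (t + t' + 1) s''
  | loop_false {c : Test} {p : Prog} {s : Memory} :
      ¬ c.Holds G I J s → Exec G I J (.loop c p) s 1 s

/-- Executions are deterministic: the running time and the final memory are determined by the
program, the input and the initial memory. -/
theorem Exec.deterministic {n : ℕ} {G : Game n} {I J : Finset (Fin n)} {p : Prog}
    {s s₁ s₂ : Memory} {t₁ t₂ : ℕ} (h₁ : Exec G I J p s t₁ s₁) (h₂ : Exec G I J p s t₂ s₂) :
    t₁ = t₂ ∧ s₁ = s₂ := by
  induction h₁ generalizing t₂ s₂ with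
  | seq _ _ ih ih' =>
    cases h₂ with
    | seq k k' =>
      obtain ⟨rfl, rfl⟩ := ih k
      obtain ⟨rfl, rfl⟩ := ih' k'
      exact ⟨rfl, rfl⟩
  | branch_true hc _ ih =>
    cases h₂ with
    | branch_true _ k => obtain ⟨rfl, rfl⟩ := ih k; exact ⟨rfl, rfl⟩
    | branch_false hc' _ => exact absurd hc hc'
  | branch_false hc _ ih =>
    cases h₂ with
    | branch_true hc' _ => exact absurd hc' hc
    | branch_false _ k => obtain ⟨rfl, rfl⟩ := ih k; exact ⟨rfl, rfl⟩
  | loop_true hc _ _ ih ih' =>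
    cases h₂ with
    | loop_true _ k k' =>
      obtain ⟨rfl, rfl⟩ := ih k
      obtain ⟨rfl, rfl⟩ := ih' k'
      exact ⟨rfl, rfl⟩
    | loop_false hc' => exact absurd hc hc'
  | loop_false hc =>
    cases h₂ with
    | loop_true hc' _ _ => exact absurd hc' hc
    | loop_false _ => exact ⟨rfl, rfl⟩
  | _ => cases h₂; exact ⟨rfl, rfl⟩

/-- Started with blank memory on input `G, I, J`, the program `p` halts after at most `T` steps,
with output (the content of register `0`) equal to `1` if `answer` is true and to `0` if it is
false. -/
def Prog.AnswersWithin {n : ℕ} (p : Prog) (G : Game n) (I J : Finset (Fin n)) (answer : Prop)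
    (T : ℕ) : Prop :=
  ∃ t ≤ T, ∃ s : Memory, Exec G I J p Memory.blank t s ∧
    ((answer ∧ s.reg 0 = 1) ∨ (¬ answer ∧ s.reg 0 = 0))

end PaymentFree

namespace PaymentFree

/-! ### Order properties of Shapley operators -/

section Shapley

variable {n : ℕ} (G : Game n)

/-! Combinatorial side. A fixed point with argmin `I` is governed only by the supports of the
transition probabilities. For a set `X` of states, consider the attractor of `I` within `X`: the
least set closed under adding the states from which MIN can stay in `X` for one step and, outside of
`I`, hit the set already built with positive probability. Then `I` is an argmin if and only if `I`
is the greatest fixed point of `X ↦ attractor of I within X` (`Game.IMin_iff_isCore`). If `u` is a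
fixed point with argmin `I`, a set contained in its own attractor cannot exceed `I`: the attractor
property would make `u` smaller than its own maximum on the set at every point of the set.
Conversely, the greatest fixed point below the indicator of the complement of `I` vanishes on `I`;
if it vanished on a state of its zero set outside the attractor, it could be raised there, against
its maximality.

The argmax is the argmin for the conjugate operator, which is the operator of a game in which MIN
chooses a reply function; on the level of predecessors this only exchanges `∃ a, ∀ b` with `∀ a, ∃
b`. The two conditions combine (`Game.IMinJMax_iff`): after rescaling, a fixed point for `I` and one
for `J` give a subsolution below a supersolution, and a fixed point lies in between.

Algorithmic side. The greatest fixed point is reached from the full set in at most `n` rounds, since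
each unfinished round loses a state. Each round computes an attractor in at most `n` steps, each
processing one new state. The point is that such a step costs `O(m₂)`: two flags are kept for each
triple, whether it hits the processed states (or starts in the target) and whether it may leave `X`.
A new state requires one probability test per triple, and the quantifiers are then evaluated by one
pass over the flags. The exit flags cost `O(n m₂)` once per round. Hence `O(n m₂)` per round and
`O(n² m₂)` in all, for each of the two instances. Correctness and cost are proved together, by loop
invariants with explicit step bounds. -/

/-- Finite infima and suprema are attained, so inequalities on the operator become alternating
quantifiers, the same pattern as in the combinatorial predecessor `Game.pre`. -/
theorem Game.shapley_le_iff (x : Fin n → ℝ) (i : Fin n) (r : ℝ) :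
    G.shapley x i ≤ r ↔ ∃ a, ∀ b, ∑ j, G.prob i a b j * x j ≤ r := by
  have : Nonempty (Fin (G.numA i)) := ⟨⟨0, G.numA_pos i⟩⟩
  have : Nonempty (Fin (G.numB i)) := ⟨⟨0, G.numB_pos i⟩⟩
  unfold Game.shapley
  constructor
  · intro h
    obtain ⟨a, ha⟩ := exists_eq_ciInf_of_finite
      (f := fun a => ⨆ b : Fin (G.numB i), ∑ j, G.prob i a b j * x j)
    refine ⟨a, fun b => le_trans ?_ (ha.trans_le h)⟩
    exact le_ciSup (f := fun b => ∑ j, G.prob i a b j * x j) (Set.finite_range _).bddAbove b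
  · rintro ⟨a, ha⟩
    exact (ciInf_le (Set.finite_range _).bddBelow a).trans (ciSup_le ha)

theorem Game.le_shapley_iff (x : Fin n → ℝ) (i : Fin n) (r : ℝ) :
    r ≤ G.shapley x i ↔ ∀ a, ∃ b, r ≤ ∑ j, G.prob i a b j * x j := by
  have : Nonempty (Fin (G.numA i)) := ⟨⟨0, G.numA_pos i⟩⟩
  have : Nonempty (Fin (G.numB i)) := ⟨⟨0, G.numB_pos i⟩⟩
  unfold Game.shapley
  constructor
  · intro h a
    obtain ⟨b, hb⟩ := exists_eq_ciSup_of_finite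
      (f := fun b : Fin (G.numB i) => ∑ j, G.prob i a b j * x j)
    exact ⟨b, (h.trans (ciInf_le (Set.finite_range _).bddBelow a)).trans_eq hb.symm⟩
  · intro h
    refine le_ciInf fun a => ?_
    obtain ⟨b, hb⟩ := h a
    exact hb.trans
      (le_ciSup (f := fun b => ∑ j, G.prob i a b j * x j) (Set.finite_range _).bddAbove b)

theorem Game.shapley_lt_iff (x : Fin n → ℝ) (i : Fin n) (r : ℝ) :
    G.shapley x i < r ↔ ∃ a, ∀ b, ∑ j, G.prob i a b j * x j < r := by
  rw [← not_le, G.le_shapley_iff]; push Not; rfl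

theorem Game.shapley_mono : Monotone G.shapley := by
  intro x y h i
  rw [G.le_shapley_iff]
  intro a
  obtain ⟨b, hb⟩ := (G.le_shapley_iff x i _).1 le_rfl a
  exact ⟨b, hb.trans (Finset.sum_le_sum fun j _ =>
    mul_le_mul_of_nonneg_left (h j) (G.prob_nonneg i a b j))⟩

theorem Game.sum_prob_affine (x : Fin n → ℝ) (i : Fin n) (a b) (r t : ℝ) :
    ∑ j, G.prob i a b j * (r * x j + t) = r * (∑ j, G.prob i a b j * x j) + t := by
  simp only [mul_add, Finset.sum_add_distrib, ← Finset.sum_mul, G.prob_sum, one_mul,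
    Finset.mul_sum]
  congr 1
  exact Finset.sum_congr rfl fun j _ => by ring

/-- Probability vectors have mass one, so averages commute with increasing affine maps. This permits
the normalization of fixed points in `Game.IMinJMax_iff`. -/
theorem Game.shapley_affine (x : Fin n → ℝ) {r : ℝ} (hr : 0 < r) (t : ℝ) :
    G.shapley (fun j => r * x j + t) = fun i => r * G.shapley x i + t := by
  funext i
  apply le_antisymm
  · rw [G.shapley_le_iff]
    obtain ⟨a, ha⟩ := (G.shapley_le_iff x i _).1 le_rfl
    refine ⟨a, fun b => ?_⟩
    rw [G.sum_prob_affine]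
    have := mul_le_mul_of_nonneg_left (ha b) hr.le
    linarith
  · rw [G.le_shapley_iff]
    intro a
    obtain ⟨b, hb⟩ := (G.le_shapley_iff x i _).1 le_rfl a
    refine ⟨b, ?_⟩
    rw [G.sum_prob_affine]
    have := mul_le_mul_of_nonneg_left hb hr.le
    linarith

theorem Game.sum_prob_le {x : Fin n → ℝ} {i : Fin n} {a b} {r : ℝ}
    (h : ∀ j, 0 < G.prob i a b j → x j ≤ r) : ∑ j, G.prob i a b j * x j ≤ r := by
  calc ∑ j, G.prob i a b j * x j ≤ ∑ j, G.prob i a b j * r := by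
        refine Finset.sum_le_sum fun j _ => ?_
        rcases (G.prob_nonneg i a b j).eq_or_lt with h0 | h0
        · simp [← h0]
        · exact mul_le_mul_of_nonneg_left (h j h0) h0.le
    _ = r := by rw [← Finset.sum_mul, G.prob_sum, one_mul]

theorem Game.le_sum_prob {x : Fin n → ℝ} {i : Fin n} {a b} {r : ℝ}
    (h : ∀ j, 0 < G.prob i a b j → r ≤ x j) : r ≤ ∑ j, G.prob i a b j * x j := by
  have := G.sum_prob_le (x := fun j => -x j) (r := -r) fun j hj => neg_le_neg (h j hj)
  simp only [mul_neg, Finset.sum_neg_distrib] at this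
  linarith

theorem Game.sum_prob_lt {x : Fin n → ℝ} {i : Fin n} {a b} {r : ℝ}
    (h : ∀ j, 0 < G.prob i a b j → x j ≤ r) {j : Fin n} (hj : 0 < G.prob i a b j)
    (hlt : x j < r) : ∑ j, G.prob i a b j * x j < r := by
  calc ∑ j, G.prob i a b j * x j < ∑ j, G.prob i a b j * r := by
        refine Finset.sum_lt_sum (fun j _ => ?_) ⟨j, Finset.mem_univ _, ?_⟩
        · rcases (G.prob_nonneg i a b j).eq_or_lt with h0 | h0
          · simp [← h0]
          · exact mul_le_mul_of_nonneg_left (h j h0) h0.le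
        · exact mul_lt_mul_of_pos_left hlt hj
    _ = r := by rw [← Finset.sum_mul, G.prob_sum, one_mul]

/-- MIN can make the argmin of a fixed point absorbing. -/
theorem Game.argmin_closed {u : Fin n → ℝ} (hu : G.shapley u = u) {i : Fin n}
    (hi : i ∈ argmin u) : ∃ a, ∀ b, ∀ j, 0 < G.prob i a b j → j ∈ argmin u := by
  obtain ⟨a, ha⟩ := (G.shapley_le_iff u i _).1 (congrFun hu i).le
  refine ⟨a, fun b j hj => ?_⟩
  by_contra hn
  have hlt : u i < u j := by
    refine lt_of_le_of_ne (hi j) fun he => hn fun k => ?_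
    rw [← he]; exact hi k
  -- For `-u`: a single reachable state above the minimum pushes the average strictly above `u i`.
  have := G.sum_prob_lt (x := fun j => -u j) (r := -u i)
    (fun j _ => neg_le_neg (hi j)) hj (neg_lt_neg hlt)
  simp only [mul_neg, Finset.sum_neg_distrib] at this
  linarith [ha b]

end Shapley

/-! ### Fixed points of monotone self-maps of `ℝⁿ` -/

/-- Knaster–Tarski in the conditionally complete lattice `ℝⁿ`: the supremum of the subsolutions
below `w` is itself a subsolution, and its image is again one of them. The subsolution `l` serves to
make this family nonempty. -/
theorem exists_greatest_fixed_point {n : ℕ} {F : (Fin n → ℝ) → (Fin n → ℝ)} (hF : Monotone F)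
    {l w : Fin n → ℝ} (hl : l ≤ F l) (hlw : l ≤ w) (hw : F w ≤ w) :
    ∃ u, F u = u ∧ u ≤ w ∧ ∀ y, y ≤ w → y ≤ F y → y ≤ u := by
  set S : Set (Fin n → ℝ) := {y | y ≤ w ∧ y ≤ F y}
  have hb : BddAbove S := ⟨w, fun y hy => hy.1⟩
  have hne : S.Nonempty := ⟨l, hlw, hl⟩
  have hle : ∀ y ∈ S, y ≤ sSup S := fun y hy => le_csSup hb hy
  have hSw : sSup S ≤ w := csSup_le hne fun y hy => hy.1
  have h1 : sSup S ≤ F (sSup S) := csSup_le hne fun y hy => hy.2.trans (hF (hle y hy))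
  have h2 : F (sSup S) ≤ sSup S := hle _ ⟨(hF hSw).trans hw, hF h1⟩
  exact ⟨sSup S, le_antisymm h2 h1, hSw, fun y hy hy' => hle y ⟨hy, hy'⟩⟩

/-! ### The conjugate operator -/

/-- The game of the conjugate operator: MIN picks a reply to each action of the former MIN, and
MAX picks that action. -/
noncomputable def Game.dual {n : ℕ} (G : Game n) : Game n where
  -- The exponential number of actions is harmless: this game occurs only in proofs and is never
  -- given to the program.
  numA i := G.numB i ^ G.numA i
  numB i := G.numA i
  numA_pos i := pow_pos (G.numB_pos i) _
  numB_pos i := G.numA_pos i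
  prob i s a := G.prob i a (finFunctionFinEquiv.symm s a)
  prob_nonneg i _ a := G.prob_nonneg i a _
  prob_sum i _ a := G.prob_sum i a _

/-- `∃ a, ∀ b` if `c` holds, and `∀ a, ∃ b` otherwise. -/
def Quant {α β : Type*} (c : Bool) (Q : α → β → Prop) : Prop :=
  if c then ∃ a, ∀ b, Q a b else ∀ a, ∃ b, Q a b

theorem Quant.mono {α β : Type*} {c : Bool} {Q R : α → β → Prop} (h : ∀ a b, Q a b → R a b)
    (hQ : Quant c Q) : Quant c R := by
  cases c
  · intro a; obtain ⟨b, hb⟩ := hQ a; exact ⟨b, h _ _ hb⟩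
  · obtain ⟨a, ha⟩ := hQ; exact ⟨a, fun b => h _ _ (ha b)⟩

/-- Choosing a reply function is Skolemization. Since `Q` is arbitrary, this one exchange serves the
operator, the predecessors and the closedness of the argmax. -/
theorem Game.exists_forall_dual {n : ℕ} (G : Game n) (i : Fin n) (Q : (Fin n → ℝ) → Prop) :
    (∃ s, ∀ a, Q (G.dual.prob i s a)) ↔ ∀ a, ∃ b, Q (G.prob i a b) := by
  constructor
  · rintro ⟨s, hs⟩ a
    exact ⟨_, hs a⟩
  · intro h
    choose f hf using h
    refine ⟨finFunctionFinEquiv f, fun a => ?_⟩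
    simp only [Game.dual, Equiv.symm_apply_apply]
    exact hf a

theorem Game.dual_shapley {n : ℕ} (G : Game n) : G.dual.shapley = conjugate G.shapley := by
  funext x i
  refine eq_of_forall_ge_iff fun r => ?_
  rw [G.dual.shapley_le_iff, G.exists_forall_dual i (fun p => ∑ j, p j * x j ≤ r)]
  simp only [conjugate, Pi.neg_apply]
  rw [neg_le, G.le_shapley_iff]
  simp only [Pi.neg_apply, mul_neg, Finset.sum_neg_distrib, neg_le_neg_iff]

/-! ### Nested attractors -/

open Classical in
/-- The states from which the controller can keep the play in `X` for one step and, outside of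
the target `T`, reach `Y` in one step with positive probability. The controller is MIN in the
given game if `c` holds, and in the dual game otherwise. -/
noncomputable def Game.pre {n : ℕ} (G : Game n) (c : Bool) (T X Y : Finset (Fin n)) :
    Finset (Fin n) :=
  Finset.univ.filter fun i => Quant c fun a b =>
    (i ∈ T ∨ ∃ j ∈ Y, 0 < G.prob i a b j) ∧ ¬ ∃ j, j ∉ X ∧ 0 < G.prob i a b j

theorem Game.mem_pre {n : ℕ} {G : Game n} {c : Bool} {T X Y : Finset (Fin n)} {i : Fin n} :
    i ∈ G.pre c T X Y ↔ Quant c fun a b =>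
      (i ∈ T ∨ ∃ j ∈ Y, 0 < G.prob i a b j) ∧ ¬ ∃ j, j ∉ X ∧ 0 < G.prob i a b j := by
  simp [Game.pre]

theorem Game.pre_mono {n : ℕ} (G : Game n) (c : Bool) (T : Finset (Fin n))
    {X X' Y Y' : Finset (Fin n)} (hX : X ⊆ X') (hY : Y ⊆ Y') :
    G.pre c T X Y ⊆ G.pre c T X' Y' := by
  intro i hi
  rw [Game.mem_pre] at hi ⊢
  refine hi.mono fun a b h => ⟨?_, ?_⟩
  · exact h.1.imp_right fun ⟨j, hj, hp⟩ => ⟨j, hY hj, hp⟩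
  · exact fun ⟨j, hj, hp⟩ => h.2 ⟨j, fun hj' => hj (hX hj'), hp⟩

theorem Game.dual_pre {n : ℕ} (G : Game n) : G.dual.pre true = G.pre false := by
  funext T X Y
  ext i
  rw [Game.mem_pre, Game.mem_pre]
  exact G.exists_forall_dual i fun p => (i ∈ T ∨ ∃ j ∈ Y, 0 < p j) ∧ ¬ ∃ j, j ∉ X ∧ 0 < p j

/-- `Y` is the least set with `f Y ⊆ Y`. -/
def IsAttr {α : Type*} (f : Finset α → Finset α) (Y : Finset α) : Prop :=
  f Y ⊆ Y ∧ ∀ Z, f Z ⊆ Z → Y ⊆ Z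

theorem IsAttr.unique {α : Type*} {f : Finset α → Finset α} {Y Z : Finset α}
    (hY : IsAttr f Y) (hZ : IsAttr f Z) : Y = Z :=
  (hY.2 Z hZ.1).antisymm (hZ.2 Y hY.1)

theorem IsAttr.fixed {α : Type*} {f : Finset α → Finset α} (hf : Monotone f) {Y : Finset α}
    (hY : IsAttr f Y) : f Y = Y :=
  hY.1.antisymm (hY.2 _ (hf hY.1))

/-- `X` is the greatest fixed point of the map sending `X` to the least fixed point of `f X`. -/
def IsCore {α : Type*} (f : Finset α → Finset α → Finset α) (X : Finset α) : Prop :=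
  IsAttr (f X) X ∧ ∀ Z Y, IsAttr (f Z) Y → Z ⊆ Y → Z ⊆ X

theorem IsCore.unique {α : Type*} {f : Finset α → Finset α → Finset α} {X Z : Finset α}
    (hX : IsCore f X) (hZ : IsCore f Z) : X = Z :=
  (hZ.2 X X hX.1 subset_rfl).antisymm (hX.2 Z Z hZ.1 subset_rfl)

/-- The intersection of all sets `Z` with `f Z ⊆ Z` has this property itself, by monotonicity. -/
theorem exists_isAttr {n : ℕ} {f : Finset (Fin n) → Finset (Fin n)} (hf : Monotone f) :
    ∃ Y, IsAttr f Y := by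
  classical
  set Y : Finset (Fin n) := Finset.univ.filter fun i => ∀ Z, f Z ⊆ Z → i ∈ Z
  have hY : ∀ Z, f Z ⊆ Z → Y ⊆ Z := fun Z hZ i hi => (Finset.mem_filter.1 hi).2 Z hZ
  refine ⟨Y, fun i hi => ?_, hY⟩
  exact Finset.mem_filter.2 ⟨Finset.mem_univ _, fun Z hZ => hZ (hf (hY Z hZ) hi)⟩

/-! ### Fixed points with prescribed extremal sets, in terms of nested attractors. -/

section Characterization

variable {n : ℕ} (G : Game n)

/-- If `Z` lies in its attractor `Y` but not in `I`, let `m` maximize `u` on `Z`, so that `u m`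
exceeds the minimum. The set `W` where `u < u m` is closed under predecessors: staying in `Z` bounds
all successor values by `u m`, and hitting `W` makes the average strictly smaller. Thus `Y ⊆ W`,
although `m ∈ Z ⊆ Y`. That `I` is its own attractor holds because MIN can keep the play in `I`
exactly from `I`. -/
theorem Game.isCore_of_IMin {I : Finset (Fin n)} (hI : I.Nonempty) (h : IMin G.shapley I) :
    IsCore (G.pre true I) I := by
  obtain ⟨u, hu, hmin⟩ := h
  have hmem : ∀ i, i ∈ I ↔ i ∈ argmin u := fun i => by rw [hmin]; rfl
  obtain ⟨i₀, hi₀⟩ := hI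
  have hlow : ∀ j, u i₀ ≤ u j := (hmem i₀).1 hi₀
  have hpos : ∀ j, j ∉ I → u i₀ < u j := fun j hj => by
    refine lt_of_le_of_ne (hlow j) fun he => hj ((hmem j).2 fun k => ?_)
    rw [← he]; exact hlow k
  have hval : ∀ j ∈ I, u j = u i₀ := fun j hj => ((hmem j).1 hj i₀).antisymm (hlow j)
  have hcl : ∀ X Y, I ⊆ X → I ⊆ G.pre true I X Y := fun X Y hX i hi => by
    obtain ⟨a, ha⟩ := G.argmin_closed hu ((hmem i).1 hi)
    rw [Game.mem_pre]
    refine ⟨a, fun b => ⟨Or.inl hi, ?_⟩⟩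
    rintro ⟨j, hj, hp⟩
    exact hj (hX ((hmem j).2 (ha b j hp)))
  have key : ∀ Z Y, IsAttr (G.pre true I Z) Y → Z ⊆ Y → Z ⊆ I := by
    intro Z Y hY hZY
    have hmono : Monotone (G.pre true I Z) := fun _ _ h => G.pre_mono _ _ subset_rfl h
    by_contra hne
    obtain ⟨z, hz, hzI⟩ := Finset.not_subset.1 hne
    obtain ⟨m, hm, hmax⟩ := Z.exists_max_image u ⟨z, hz⟩
    have hm0 : u i₀ < u m := (hpos z hzI).trans_le (hmax z hz)
    let W : Finset (Fin n) := Finset.univ.filter fun i => u i < u m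
    have hW : G.pre true I Z W ⊆ W := by
      intro i hi
      refine Finset.mem_filter.2 ⟨Finset.mem_univ _, ?_⟩
      rw [Game.mem_pre] at hi
      obtain ⟨a, ha⟩ := hi
      by_cases hiI : i ∈ I
      · rw [hval i hiI]; exact hm0
      · rw [← congrFun hu i, G.shapley_lt_iff]
        refine ⟨a, fun b => ?_⟩
        obtain ⟨h1, h2⟩ := ha b
        obtain ⟨j, hj, hp⟩ := h1.resolve_left hiI
        refine G.sum_prob_lt (fun k hk => hmax k ?_) hp (Finset.mem_filter.1 hj).2
        by_contra hkZ
        exact h2 ⟨k, hkZ, hk⟩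
    exact lt_irrefl _ (Finset.mem_filter.1 (hY.2 W hW (hZY hm))).2
  refine ⟨⟨?_, fun Z hZ => ?_⟩, key⟩
  · intro i hi
    rw [Game.mem_pre] at hi
    obtain ⟨a, ha⟩ := hi
    have hle : u i ≤ u i₀ := by
      rw [← congrFun hu i, G.shapley_le_iff]
      refine ⟨a, fun b => G.sum_prob_le fun j hj => ?_⟩
      by_cases hjI : j ∈ I
      · exact (hval j hjI).le
      · exact absurd ⟨j, hjI, hj⟩ (ha b).2
    by_contra hiI
    exact absurd (hpos i hiI) (not_lt.2 hle)
  · exact (hcl I Z subset_rfl).trans hZ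

/-- A common lower bound for all positive values of `u` and all positive probabilities, used to
choose the size of the perturbation in `Game.IMin_of_isCore`. -/
theorem Game.exists_pos_lower_bound (u : Fin n → ℝ) :
    ∃ d : ℝ, 0 < d ∧ d ≤ 1 ∧ (∀ j, 0 < u j → d ≤ u j) ∧
      ∀ i a b j, 0 < G.prob i a b j → d ≤ G.prob i a b j := by
  classical
  have fin : ∀ {ι : Type} [Finite ι] (f : ι → ℝ), ∃ d : ℝ, 0 < d ∧ d ≤ 1 ∧
      ∀ x, 0 < f x → d ≤ f x := by
    intro ι _ f
    have := Fintype.ofFinite ι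
    have hne : (insert 1 ((Finset.univ.image f).filter (0 < ·))).Nonempty :=
      Finset.insert_nonempty _ _
    refine ⟨(insert 1 ((Finset.univ.image f).filter (0 < ·))).min' hne, ?_, ?_, ?_⟩
    · rw [Finset.lt_min'_iff]
      intro y hy
      rcases Finset.mem_insert.1 hy with rfl | hy
      · exact one_pos
      · exact (Finset.mem_filter.1 hy).2
    · exact Finset.min'_le _ _ (Finset.mem_insert_self _ _)
    · intro x hx
      exact Finset.min'_le _ _ (Finset.mem_insert_of_mem (Finset.mem_filter.2
        ⟨Finset.mem_image_of_mem _ (Finset.mem_univ _), hx⟩))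
  obtain ⟨d₁, h1, h1', h1''⟩ := fin u
  obtain ⟨d₂, h2, h2', h2''⟩ := fin
    fun x : (Σ i : Fin n, Fin (G.numA i) × Fin (G.numB i)) × Fin n =>
      G.prob x.1.1 x.1.2.1 x.1.2.2 x.2
  exact ⟨min d₁ d₂, lt_min h1 h2, (min_le_left _ _).trans h1',
    fun j hj => (min_le_left _ _).trans (h1'' j hj),
    fun i a b j hj => (min_le_right _ _).trans (h2'' (⟨i, a, b⟩, j) hj)⟩

/-- The indicator `e` of the complement of `I` is a supersolution because MIN can stay in `I`. Let
`u` be the greatest fixed point below `e`. It is nonnegative and vanishes on `I`; maximality shows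
that its zero set `Z` lies in the attractor of `I` within `Z`, and the core property then gives `Z ⊆
I`. -/
theorem Game.IMin_of_isCore {I : Finset (Fin n)} (hI : I.Nonempty)
    (h : IsCore (G.pre true I) I) : IMin G.shapley I := by
  classical
  have hmono : ∀ X, Monotone (G.pre true I X) := fun X _ _ h => G.pre_mono _ _ subset_rfl h
  have hcl : ∀ i ∈ I, ∃ a, ∀ b, ∀ j, 0 < G.prob i a b j → j ∈ I := by
    intro i hi
    rw [← h.1.fixed (hmono I), Game.mem_pre] at hi
    obtain ⟨a, ha⟩ := hi
    exact ⟨a, fun b j hj => by_contra fun hn => (ha b).2 ⟨j, hn, hj⟩⟩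
  let e : Fin n → ℝ := fun i => if i ∈ I then 0 else 1
  have he0 : ∀ i ∈ I, e i = 0 := fun i hi => if_pos hi
  have he1 : ∀ i, i ∉ I → e i = 1 := fun i hi => if_neg hi
  have hele : ∀ i, e i ≤ 1 := fun i => by by_cases hi : i ∈ I <;> simp [e, hi]
  have hege : ∀ i, 0 ≤ e i := fun i => by by_cases hi : i ∈ I <;> simp [e, hi]
  have hFe : G.shapley e ≤ e := by
    intro i
    rw [G.shapley_le_iff]
    by_cases hi : i ∈ I
    · obtain ⟨a, ha⟩ := hcl i hi
      refine ⟨a, fun b => G.sum_prob_le fun j hj => ?_⟩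
      rw [he0 i hi, he0 j (ha b j hj)]
    · refine ⟨⟨0, G.numA_pos i⟩, fun b => G.sum_prob_le fun j _ => ?_⟩
      rw [he1 i hi]; exact hele j
  have hF0 : (0 : Fin n → ℝ) ≤ G.shapley 0 := by
    intro i
    rw [G.le_shapley_iff]
    exact fun a => ⟨⟨0, G.numB_pos i⟩, by simp⟩
  obtain ⟨u, hu, hue, hgreat⟩ := exists_greatest_fixed_point G.shapley_mono hF0 hege hFe
  have hu0 : ∀ i, 0 ≤ u i := hgreat 0 hege hF0
  have huI : ∀ i ∈ I, u i = 0 := fun i hi => ((hue i).trans_eq (he0 i hi)).antisymm (hu0 i)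
  let Z : Finset (Fin n) := Finset.univ.filter fun i => u i = 0
  have hZ : ∀ i, i ∈ Z ↔ u i = 0 := fun i => by simp [Z]
  have hIZ : I ⊆ Z := fun i hi => (hZ i).2 (huI i hi)
  obtain ⟨Y, hY⟩ := exists_isAttr (hmono Z)
  have hIY : I ⊆ Y := fun i hi => hY.1 (by
    obtain ⟨a, ha⟩ := hcl i hi
    rw [Game.mem_pre]
    exact ⟨a, fun b => ⟨Or.inl hi, fun ⟨j, hj, hp⟩ => hj (hIZ (ha b j hp))⟩⟩)
  have hZY : Z ⊆ Y := by
    obtain ⟨d, hd, hd1, hdu, hdP⟩ := G.exists_pos_lower_bound u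
    -- Raise `u` to `d * d` on `Z \ Y`. There, against each action of MIN, MAX has a reply that
    -- either leaves `Z`, reaching a value at least `d` with probability at least `d`, or stays in
    -- `Z` and avoids `Y`, hence stays in `Z \ Y`. So `w` is a subsolution below `e`, and `w ≤ u`
    -- forces `Z \ Y` to be empty.
    let w : Fin n → ℝ := fun i => if i ∈ Z ∧ i ∉ Y then d * d else u i
    have huw : u ≤ w := by
      intro i
      by_cases hi : i ∈ Z ∧ i ∉ Y
      · simp only [w, if_pos hi, (hZ i).1 hi.1]; positivity
      · simp only [w, if_neg hi]; exact le_rfl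
    have hwe : w ≤ e := by
      intro i
      by_cases hi : i ∈ Z ∧ i ∉ Y
      · simp only [w, if_pos hi, he1 i fun h => hi.2 (hIY h)]; nlinarith
      · simp only [w, if_neg hi]; exact hue i
    have hwF : w ≤ G.shapley w := by
      intro i
      by_cases hi : i ∈ Z ∧ i ∉ Y
      · have hni : i ∉ G.pre true I Z Y := fun h => hi.2 (hY.1 h)
        have hiI : i ∉ I := fun h => hi.2 (hIY h)
        rw [Game.mem_pre] at hni
        simp only [Quant, if_true] at hni
        push Not at hni
        have hwi : w i = d * d := if_pos hi
        rw [hwi, G.le_shapley_iff]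
        intro a
        obtain ⟨b, hb⟩ := hni a
        refine ⟨b, ?_⟩
        by_cases hsupp : ∃ j, j ∉ Z ∧ 0 < G.prob i a b j
        · obtain ⟨j, hjZ, hj⟩ := hsupp
          have hju : 0 < u j := lt_of_le_of_ne (hu0 j) fun h => hjZ ((hZ j).2 h.symm)
          calc d * d ≤ G.prob i a b j * w j :=
                mul_le_mul (hdP i a b j hj) ((hdu j hju).trans (huw j)) hd.le hj.le
            _ ≤ _ := Finset.single_le_sum (f := fun j => G.prob i a b j * w j)
                (fun k _ => mul_nonneg (G.prob_nonneg i a b k) ((hu0 k).trans (huw k)))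
                (Finset.mem_univ j)
        · push Not at hsupp
          refine G.le_sum_prob fun j hj => ?_
          have hjZ : j ∈ Z := by
            by_contra hjZ
            exact absurd hj (not_lt.2 (hsupp j hjZ))
          have hjY : j ∉ Y := by
            intro hjY
            obtain ⟨k, hk, hk'⟩ := hb (Or.inr ⟨j, hjY, hj⟩)
            exact absurd hk' (not_lt.2 (hsupp k hk))
          exact (if_pos ⟨hjZ, hjY⟩ : w j = d * d).ge
      · have hwi : w i = u i := if_neg hi
        rw [hwi]
        calc u i = G.shapley u i := (congrFun hu i).symm
          _ ≤ _ := G.shapley_mono huw i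
    have hwu := hgreat w hwe hwF
    intro i hi
    by_contra hiY
    have h1 := hwu i
    have h2 : w i = d * d := if_pos ⟨hi, hiY⟩
    rw [h2, (hZ i).1 hi] at h1
    nlinarith
  have hZI : Z ⊆ I := h.2 Z Y hY hZY
  refine ⟨u, hu, ?_⟩
  obtain ⟨i₀, hi₀⟩ := hI
  ext i
  constructor
  · intro hi
    exact hZI ((hZ i).2 (((hi i₀).trans_eq (huI i₀ hi₀)).antisymm (hu0 i)))
  · intro hi j
    rw [huI i hi]; exact hu0 j

theorem Game.IMin_iff_isCore {I : Finset (Fin n)} (hI : I.Nonempty) :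
    IMin G.shapley I ↔ IsCore (G.pre true I) I :=
  ⟨G.isCore_of_IMin hI, G.IMin_of_isCore hI⟩

theorem Game.IMin_conjugate_iff_isCore {I : Finset (Fin n)} (hI : I.Nonempty) :
    IMin (conjugate G.shapley) I ↔ IsCore (G.pre false I) I := by
  rw [← G.dual_shapley, G.dual.IMin_iff_isCore hI, G.dual_pre]

/-- For the converse, rescale the two fixed points to `u' ≥ 0` vanishing exactly on `I` and `v' ≤ 1`
equal to `1` exactly on `J`, with `u' ≤ v'`. Raising `u'` to `1` on `J` keeps a subsolution, since
MAX can stay in `J`; lowering `v'` to `0` on `I` keeps a supersolution, since MIN can stay in `I`. A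
fixed point between the two has the required argmin and argmax. -/
theorem Game.IMinJMax_iff {I J : Finset (Fin n)} (hI : I.Nonempty) (hJ : J.Nonempty)
    (hIJ : Disjoint I J) :
    IMinJMax G.shapley I J ↔ IMin G.shapley I ∧ IMin (conjugate G.shapley) J := by
  classical
  constructor
  · rintro ⟨u, hu, hmin, hmax⟩
    refine ⟨⟨u, hu, hmin⟩, -u, by simp [conjugate, hu], ?_⟩
    rw [← hmax]
    ext i
    simp [argmin, argmax]
  · rintro ⟨⟨u, hu, hmin⟩, ⟨v, hv, hvmin⟩⟩
    have hclI : ∀ i ∈ I, ∃ a, ∀ b, ∀ j, 0 < G.prob i a b j → j ∈ I := by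
      intro i hi
      obtain ⟨a, ha⟩ := G.argmin_closed hu (i := i) (by rw [hmin]; exact hi)
      exact ⟨a, fun b j hj => by have := ha b j hj; rw [hmin] at this; exact this⟩
    have hclJ : ∀ i ∈ J, ∀ a, ∃ b, ∀ j, 0 < G.prob i a b j → j ∈ J := by
      intro i hi
      rw [← G.dual_shapley] at hv
      have := G.dual.argmin_closed hv (i := i) (by rw [hvmin]; exact hi)
      rw [G.exists_forall_dual i fun p => ∀ j, 0 < p j → j ∈ argmin v] at this
      rw [hvmin] at this
      exact this
    obtain ⟨i₀, hi₀⟩ := hI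
    obtain ⟨j₀, hj₀⟩ := hJ
    have hui : ∀ i, i ∈ I ↔ ∀ j, u i ≤ u j := fun i => by
      rw [← Finset.mem_coe, ← hmin]; rfl
    have hvj : ∀ i, i ∈ J ↔ ∀ j, v i ≤ v j := fun i => by
      rw [← Finset.mem_coe, ← hvmin]; rfl
    obtain ⟨K, hK⟩ : ∃ K : ℝ, ∀ i, u i - u i₀ + (v i - v j₀) ≤ K := by
      obtain ⟨K, hK⟩ := (Set.finite_range fun i => u i - u i₀ + (v i - v j₀)).bddAbove
      exact ⟨K, fun i => hK ⟨i, rfl⟩⟩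
    have hK0 : 0 ≤ K := by
      have h1 := (hui i₀).1 hi₀ i₀
      have h2 := (hvj j₀).1 hj₀ i₀
      linarith [hK i₀]
    -- The scale is such that `r` times the sum of the two rises above the minima is at most `1`,
    -- which is precisely `u' ≤ v'`; `K + 1` avoids division by zero.
    let r : ℝ := (K + 1)⁻¹
    have hr : 0 < r := by positivity
    have hrK : ∀ t, t ≤ K → r * t ≤ 1 := fun t ht => by
      have : r * (K + 1) = 1 := inv_mul_cancel₀ (by positivity)
      nlinarith
    let u' : Fin n → ℝ := fun i => r * u i + -(r * u i₀)
    let v' : Fin n → ℝ := fun i => r * (-v) i + (1 + r * v j₀)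
    have hu' : G.shapley u' = u' := by
      rw [G.shapley_affine u hr, hu]
    have hv' : G.shapley v' = v' := by
      have hv2 : G.shapley (-v) = -v := by rw [← neg_inj, neg_neg]; exact hv
      rw [G.shapley_affine (-v) hr, hv2]
    have hu'0 : ∀ i, 0 ≤ u' i := fun i => by
      have := mul_le_mul_of_nonneg_left ((hui i₀).1 hi₀ i) hr.le
      simp only [u']; linarith
    have hu'I : ∀ i ∈ I, u' i = 0 := fun i hi => by
      have : u i = u i₀ := ((hui i).1 hi i₀).antisymm ((hui i₀).1 hi₀ i)
      simp only [u', this]; ring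
    have hu'pos : ∀ i, i ∉ I → 0 < u' i := fun i hi => by
      have h1 : u i₀ < u i := by
        refine lt_of_le_of_ne ((hui i₀).1 hi₀ i) fun he => hi ((hui i).2 fun k => ?_)
        rw [← he]; exact (hui i₀).1 hi₀ k
      have := mul_lt_mul_of_pos_left h1 hr
      simp only [u']; linarith
    have hv'1 : ∀ i, v' i ≤ 1 := fun i => by
      have := mul_le_mul_of_nonneg_left ((hvj j₀).1 hj₀ i) hr.le
      simp only [v', Pi.neg_apply]; linarith
    have hv'J : ∀ i ∈ J, v' i = 1 := fun i hi => by
      have : v i = v j₀ := ((hvj i).1 hi j₀).antisymm ((hvj j₀).1 hj₀ i)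
      simp only [v', Pi.neg_apply, this]; ring
    have hv'lt : ∀ i, i ∉ J → v' i < 1 := fun i hi => by
      have h1 : v j₀ < v i := by
        refine lt_of_le_of_ne ((hvj j₀).1 hj₀ i) fun he => hi ((hvj i).2 fun k => ?_)
        rw [← he]; exact (hvj j₀).1 hj₀ k
      have := mul_lt_mul_of_pos_left h1 hr
      simp only [v', Pi.neg_apply]; linarith
    have huv : ∀ i, u' i ≤ v' i := fun i => by
      have := hrK _ (hK i)
      simp only [u', v', Pi.neg_apply]; linarith
    let l : Fin n → ℝ := fun i => if i ∈ J then 1 else u' i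
    let w : Fin n → ℝ := fun i => if i ∈ I then 0 else v' i
    have hu'1 : ∀ i, u' i ≤ 1 := fun i => (huv i).trans (hv'1 i)
    have hv'0 : ∀ i, 0 ≤ v' i := fun i => (hu'0 i).trans (huv i)
    have hul : u' ≤ l := fun i => by
      by_cases hi : i ∈ J <;> simp [l, hi, hu'1]
    have hwv : w ≤ v' := fun i => by
      by_cases hi : i ∈ I <;> simp [w, hi, hv'0]
    have hlw : l ≤ w := fun i => by
      by_cases hi : i ∈ I
      · have hj : i ∉ J := Finset.disjoint_left.1 hIJ hi
        simp [l, w, hi, hj, hu'I i hi]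
      · by_cases hj : i ∈ J
        · simp [l, w, hi, hj, hv'J i hj]
        · simp [l, w, hi, hj, huv i]
    have hFl : l ≤ G.shapley l := fun i => by
      by_cases hj : i ∈ J
      · rw [G.le_shapley_iff]
        intro a
        obtain ⟨b, hb⟩ := hclJ i hj a
        refine ⟨b, G.le_sum_prob fun k hk => ?_⟩
        simp [l, hj, hb k hk]
      · calc l i = G.shapley u' i := by rw [hu']; simp [l, hj]
          _ ≤ _ := G.shapley_mono hul i
    have hFw : G.shapley w ≤ w := fun i => by
      by_cases hi : i ∈ I
      · rw [G.shapley_le_iff]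
        obtain ⟨a, ha⟩ := hclI i hi
        refine ⟨a, fun b => G.sum_prob_le fun k hk => ?_⟩
        simp [w, hi, ha b k hk]
      · calc G.shapley w i ≤ G.shapley v' i := G.shapley_mono hwv i
          _ = w i := by rw [hv']; simp [w, hi]
    obtain ⟨x, hx, hxw, hgr⟩ := exists_greatest_fixed_point G.shapley_mono hFl hlw hFw
    have hlx : l ≤ x := hgr l hlw hFl
    have hxI : ∀ i ∈ I, x i = 0 := fun i hi => by
      have h1 := hxw i
      have h2 := (hu'0 i).trans ((hul i).trans (hlx i))
      simp only [w, if_pos hi] at h1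
      exact h1.antisymm h2
    have hxJ : ∀ i ∈ J, x i = 1 := fun i hi => by
      have h1 := hlx i
      have h2 := (hxw i).trans ((hwv i).trans (hv'1 i))
      simp only [l, if_pos hi] at h1
      exact h2.antisymm h1
    have hx0 : ∀ i, 0 ≤ x i := fun i => (hu'0 i).trans ((hul i).trans (hlx i))
    have hx1 : ∀ i, x i ≤ 1 := fun i => (hxw i).trans ((hwv i).trans (hv'1 i))
    refine ⟨x, hx, ?_, ?_⟩
    · ext i
      refine ⟨fun hi => ?_, fun hi j => by rw [hxI i hi]; exact hx0 j⟩
      by_contra hn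
      have h1 := (hu'pos i hn).trans_le ((hul i).trans (hlx i))
      have h2 := hi i₀
      rw [hxI i₀ hi₀] at h2
      linarith
    · ext i
      refine ⟨fun hi => ?_, fun hi j => by rw [hxJ i hi]; exact hx1 j⟩
      by_contra hn
      have h1 := ((hxw i).trans (hwv i)).trans_lt (hv'lt i hn)
      have h2 := hi j₀
      rw [hxJ j₀ hj₀] at h2
      linarith

end Characterization

/-! ### Comparison of the two time bounds. -/

theorem Game.sq_mul_m₂_le {n : ℕ} (G : Game n) : n ^ 2 * G.m₂ ≤ n ^ 3 * G.maxActions ^ 2 := by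
  have h : G.m₂ ≤ n * G.maxActions ^ 2 := by
    calc G.m₂ ≤ ∑ _i : Fin n, G.maxActions ^ 2 := by
          refine Finset.sum_le_sum fun i _ => ?_
          have hi : max (G.numA i) (G.numB i) ≤ G.maxActions :=
            Finset.le_sup (f := fun i => max (G.numA i) (G.numB i)) (Finset.mem_univ i)
          rw [sq]
          exact Nat.mul_le_mul ((le_max_left _ _).trans hi) ((le_max_right _ _).trans hi)
      _ = n * G.maxActions ^ 2 := by simp
  calc n ^ 2 * G.m₂ ≤ n ^ 2 * (n * G.maxActions ^ 2) := Nat.mul_le_mul_left _ h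
    _ = n ^ 3 * G.maxActions ^ 2 := by ring

/-! ### Reasoning about programs -/

@[simp] theorem Memory.setReg_reg (s : Memory) (x v r : ℕ) :
    (s.setReg x v).reg r = if r = x then v else s.reg r := by
  simp [Memory.setReg, Function.update_apply]

@[simp] theorem Memory.setReg_arr (s : Memory) (x v : ℕ) : (s.setReg x v).arr = s.arr := rfl

@[simp] theorem Memory.setArr_reg (s : Memory) (k c v : ℕ) : (s.setArr k c v).reg = s.reg := rfl

@[simp] theorem Memory.setArr_arr (s : Memory) (k c v k' : ℕ) :
    (s.setArr k c v).arr k' = if k' = k then Function.update (s.arr k) c v else s.arr k' := by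
  simp only [Memory.setArr, Function.update_apply]

/-- `p` started with memory `s` halts after at most `T` steps with a memory satisfying `Q`. -/
def Runs {n : ℕ} (G : Game n) (I J : Finset (Fin n)) (p : Prog) (s : Memory) (T : ℕ)
    (Q : Memory → Prop) : Prop :=
  ∃ t ≤ T, ∃ s', Exec G I J p s t s' ∧ Q s'

/-- The weakest precondition of a program without loops. -/
def Prog.wp {n : ℕ} (G : Game n) (I J : Finset (Fin n)) :
    Prog → (Memory → Prop) → Memory → Prop
  | .skip, Q, s => Q s
  | .const x c, Q, s => Q (s.setReg x c)
  | .copy x y, Q, s => Q (s.setReg x (s.reg y))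
  | .succ x, Q, s => Q (s.setReg x (s.reg x + 1))
  | .pred x, Q, s => Q (s.setReg x (s.reg x - 1))
  | .load x k y, Q, s => Q (s.setReg x (s.arr k (s.reg y)))
  | .store k x y, Q, s => Q (s.setArr k (s.reg x) (s.reg y))
  | .readN x, Q, s => Q (s.setReg x n)
  | .readA x y, Q, s => Q (s.setReg x (lookup G.numA (s.reg y)))
  | .readB x y, Q, s => Q (s.setReg x (lookup G.numB (s.reg y)))
  | .seq p q, Q, s => p.wp G I J (q.wp G I J Q) s
  | .branch c p q, Q, s =>
      (c.Holds G I J s → p.wp G I J Q s) ∧ (¬ c.Holds G I J s → q.wp G I J Q s)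
  | .loop _ _, _, _ => False

/-- A bound for the number of steps of a program without loops. -/
def Prog.cost : Prog → ℕ
  | .seq p q => p.cost + q.cost
  | .branch _ p q => max p.cost q.cost + 1
  | _ => 1

section Rules

variable {n : ℕ} {G : Game n} {I J : Finset (Fin n)}

theorem Runs.mono {p : Prog} {s : Memory} {T T' : ℕ} {Q Q' : Memory → Prop}
    (h : Runs G I J p s T Q) (hT : T ≤ T') (hQ : ∀ s', Q s' → Q' s') : Runs G I J p s T' Q' := by
  obtain ⟨t, ht, s', he, hq⟩ := h
  exact ⟨t, ht.trans hT, s', he, hQ s' hq⟩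

theorem Runs.seq {p q : Prog} {s : Memory} {T T' : ℕ} {Q Q' : Memory → Prop}
    (h : Runs G I J p s T Q) (h' : ∀ s', Q s' → Runs G I J q s' T' Q') :
    Runs G I J (.seq p q) s (T + T') Q' := by
  obtain ⟨t, ht, s', he, hq⟩ := h
  obtain ⟨t', ht', s'', he', hq'⟩ := h' s' hq
  exact ⟨t + t', add_le_add ht ht', s'', he.seq he', hq'⟩

theorem Runs.of_wp {p : Prog} {s : Memory} {T : ℕ} {Q : Memory → Prop}
    (h : p.wp G I J Q s) (hT : p.cost ≤ T) : Runs G I J p s T Q := by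
  refine Runs.mono (Q := Q) (T := p.cost) ?_ hT fun _ => id
  clear hT
  induction p generalizing s Q with
  | seq p q ihp ihq => exact (ihp h).seq fun s' hs' => ihq hs'
  | branch c p q ihp ihq =>
    by_cases hc : c.Holds G I J s
    · obtain ⟨t, ht, s', he, hq⟩ := ihp (h.1 hc)
      exact ⟨t + 1, Nat.succ_le_succ (ht.trans (le_max_left _ _)), s', he.branch_true hc, hq⟩
    · obtain ⟨t, ht, s', he, hq⟩ := ihq (h.2 hc)
      exact ⟨t + 1, Nat.succ_le_succ (ht.trans (le_max_right _ _)), s', he.branch_false hc, hq⟩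
  | loop => exact h.elim
  | _ => exact ⟨1, le_rfl, _, by constructor, h⟩

/-- For `x` from `0` up to, but not including, the content of register `y`, do `p`. -/
def Prog.forLoop (x y : ℕ) (p : Prog) : Prog :=
  .seq (.const x 0) (.loop (.lt x y) (.seq p (.succ x)))

/-- An iteration costs two steps besides the body (test and increment); the initialization and the
failing last test cost two more. The invariant is required after the counter has been set, so it may
mention the counter. -/
theorem Runs.forLoop {x y : ℕ} {p : Prog} {s : Memory} {T : ℕ → ℕ} {L B : ℕ}
    {Inv : ℕ → Memory → Prop} (hxy : y ≠ x) (hL : s.reg y = L) (h0 : Inv 0 (s.setReg x 0))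
    (hstep : ∀ i < L, ∀ s, s.reg x = i → s.reg y = L → Inv i s →
      Runs G I J p s (T i) fun s' =>
        s'.reg x = i ∧ s'.reg y = L ∧ Inv (i + 1) (s'.setReg x (i + 1)))
    (hB : ∑ i ∈ Finset.range L, (T i + 2) + 2 ≤ B) :
    Runs G I J (.forLoop x y p) s B (Inv L) := by
  -- Induction on the number `d` of remaining iterations.
  have key : ∀ d i s, i + d = L → s.reg x = i → s.reg y = L → Inv i s →
      Runs G I J (.loop (.lt x y) (.seq p (.succ x))) s
        (∑ k ∈ Finset.range d, (T (i + k) + 2) + 1) (Inv L) := by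
    intro d
    induction d with
    | zero =>
      intro i s hi hx hy hinv
      have : i = L := by omega
      subst this
      exact ⟨1, by simp, s, .loop_false (by simp [Test.Holds, hx, hy]), hinv⟩
    | succ d ih =>
      intro i s hi hx hy hinv
      obtain ⟨t, ht, s₁, he, hx₁, hy₁, hinv₁⟩ := hstep i (by omega) s hx hy hinv
      have he₂ := Exec.succ (G := G) (I := I) (J := J) x s₁
      rw [hx₁] at he₂
      obtain ⟨t', ht', s', he', hq⟩ := ih (i + 1) (s₁.setReg x (i + 1)) (by omega)
        (by simp) (by simp [hxy, hy₁]) hinv₁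
      refine ⟨t + 1 + t' + 1, ?_, s', .loop_true ?_ (he.seq he₂) he', hq⟩
      · rw [Finset.sum_range_succ']
        have : ∀ k, i + 1 + k = i + (k + 1) := fun k => by omega
        simp only [this] at ht'
        simp only [add_zero]
        omega
      · simp only [Test.Holds, hx, hy]; omega
  obtain ⟨t, ht, s', he, hq⟩ := key L 0 (s.setReg x 0) (by simp) (by simp)
    (by simp [hxy, hL]) h0
  simp only [zero_add] at ht
  exact ⟨1 + t, by omega, s', (Exec.const x 0 s).seq he, hq⟩

end Rules

/-- The registers from `m` on are the same in both memories. -/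
def SameAbove (m : ℕ) (s s' : Memory) : Prop := ∀ r, m ≤ r → s'.reg r = s.reg r

theorem SameAbove.refl (m : ℕ) (s : Memory) : SameAbove m s s := fun _ _ => rfl

theorem SameAbove.trans {m : ℕ} {s s' s'' : Memory} (h : SameAbove m s s')
    (h' : SameAbove m s' s'') : SameAbove m s s'' :=
  fun r hr => (h' r hr).trans (h r hr)

theorem SameAbove.weaken {m m' : ℕ} {s s' : Memory} (h : SameAbove m s s') (hm : m ≤ m') :
    SameAbove m' s s' :=
  fun r hr => h r (hm.trans hr)

theorem SameAbove.setReg {m : ℕ} {s s' : Memory} (h : SameAbove m s s') {x : ℕ} (hx : x < m)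
    (v : ℕ) : SameAbove m s (s'.setReg x v) := fun r hr => by
  rw [Memory.setReg_reg, if_neg (by omega)]; exact h r hr

theorem SameAbove.setArr {m : ℕ} {s s' : Memory} (h : SameAbove m s s') (k c v : ℕ) :
    SameAbove m s (s'.setArr k c v) := h

/-- The number `v` is the truth value of `P`. -/
def Codes (v : ℕ) (P : Prop) : Prop := (P ∧ v = 1) ∨ (¬ P ∧ v = 0)

theorem Codes.congr {v : ℕ} {P Q : Prop} (h : Codes v P) (hPQ : P ↔ Q) : Codes v Q := by
  rwa [Codes, ← hPQ]

theorem codes_one {P : Prop} (h : P) : Codes 1 P := Or.inl ⟨h, rfl⟩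

theorem codes_zero {P : Prop} (h : ¬ P) : Codes 0 P := Or.inr ⟨h, rfl⟩

theorem Codes.eq_one_iff {v : ℕ} {P : Prop} (h : Codes v P) : v = 1 ↔ P := by
  rcases h with ⟨h, rfl⟩ | ⟨h, rfl⟩ <;> simp [h]

theorem Codes.eq_zero_iff {v : ℕ} {P : Prop} (h : Codes v P) : v = 0 ↔ ¬ P := by
  rcases h with ⟨h, rfl⟩ | ⟨h, rfl⟩ <;> simp [h]

/-- The table `f` codes the set `X`. -/
def CodesSet {n : ℕ} (f : ℕ → ℕ) (X : Finset (Fin n)) : Prop := ∀ i : Fin n, Codes (f i) (i ∈ X)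

/-! ### The enumeration of the triples of a state and two actions -/

section Triples

variable {n : ℕ} (G : Game n)

/-- A state, an action of MIN and an action of MAX. -/
abbrev Game.Triple : Type := Σ i : Fin n, Fin (G.numA i) × Fin (G.numB i)

theorem lookup_val (f : Fin n → ℕ) (i : Fin n) : lookup f i = f i := by
  simp [lookup, i.2]

/-- The number of triples with state less than `i`. -/
def Game.offset (i : ℕ) : ℕ := ∑ k ∈ Finset.range i, lookup G.numA k * lookup G.numB k

/-- The number of a triple in the lexicographic order. -/
def Game.index (τ : G.Triple) : ℕ := G.offset τ.1 + τ.2.1 * G.numB τ.1 + τ.2.2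

theorem Game.offset_succ (i : Fin n) :
    G.offset (i + 1) = G.offset i + G.numA i * G.numB i := by
  rw [Game.offset, Finset.sum_range_succ, lookup_val, lookup_val, Game.offset]

theorem Game.offset_card : G.offset n = G.m₂ := by
  rw [Game.offset, Game.m₂, Finset.sum_range]
  exact Finset.sum_congr rfl fun i _ => by rw [lookup_val, lookup_val]

theorem Game.offset_mono : Monotone G.offset := fun _ _ h =>
  Finset.sum_le_sum_of_subset (Finset.range_subset_range.2 h)

theorem Game.index_lt_offset (τ : G.Triple) : G.index τ < G.offset (τ.1 + 1) := by
  obtain ⟨i, a, b⟩ := τ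
  rw [G.offset_succ, Game.index]
  have h : ((a : ℕ) + 1) * G.numB i ≤ G.numA i * G.numB i := Nat.mul_le_mul_right _ a.2
  have hb := b.2
  dsimp only
  rw [add_mul] at h
  omega

theorem Game.index_lt (τ : G.Triple) : G.index τ < G.m₂ :=
  (G.index_lt_offset τ).trans_le (G.offset_card ▸ G.offset_mono τ.1.2)

theorem Game.offset_le_index (τ : G.Triple) : G.offset τ.1 ≤ G.index τ := by
  rw [Game.index]; omega

/-- Different states occupy disjoint blocks between consecutive offsets, and within a block
Euclidean division by `numB` recovers the actions. Hence writing the flag of one triple leaves all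
others intact. -/
theorem Game.index_injective : Function.Injective G.index := by
  intro τ τ' h
  have hi : τ.1 = τ'.1 := by
    by_contra hne
    rcases lt_or_gt_of_ne hne with hlt | hlt
    · have := (G.index_lt_offset τ).trans_le
        ((G.offset_mono (Fin.lt_def.1 hlt)).trans (G.offset_le_index τ'))
      omega
    · have := (G.index_lt_offset τ').trans_le
        ((G.offset_mono (Fin.lt_def.1 hlt)).trans (G.offset_le_index τ))
      omega
  obtain ⟨i, a, b⟩ := τ
  obtain ⟨i', a', b'⟩ := τ'
  dsimp only at hi
  subst hi
  simp only [Game.index] at h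
  have h' : (a : ℕ) * G.numB i + b = a' * G.numB i + b' := by omega
  have ha : (a : ℕ) = a' := by
    have h1 := congrArg (· / G.numB i) h'
    simpa [Nat.add_div_of_dvd_right, Nat.mul_div_cancel _ (G.numB_pos i),
      Nat.div_eq_of_lt b.2, Nat.div_eq_of_lt b'.2, mul_comm _ (G.numB i),
      Nat.mul_add_div (G.numB_pos i)] using h1
  have hb : (b : ℕ) = b' := by rw [ha] at h'; omega
  rw [Fin.ext ha, Fin.ext hb]

/-- Each state has at least one triple; this absorbs the `O(n)` costs into `m₂`. -/
theorem Game.le_m₂ : n ≤ G.m₂ := by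
  calc n = ∑ _i : Fin n, 1 := by simp
    _ ≤ G.m₂ := Finset.sum_le_sum fun i _ => Nat.mul_pos (G.numA_pos i) (G.numB_pos i)

/-- The table `f` codes the set of triples satisfying `R`. -/
def Game.CodesTriples (f : ℕ → ℕ) (R : G.Triple → Prop) : Prop :=
  ∀ τ, Codes (f (G.index τ)) (R τ)

end Triples

/-! ### Scanning the triples

Registers: `1`, `4`, `7` hold `b`, `a`, `i`, and `8` holds the number of the triple `(i, a, b)`;
`2`, `5` hold the numbers of actions; `0`, `3`, `6`, `9` are for intermediate results;
`10`, `11`, `12` belong to the calling programs; `20`, `21`, `22` hold `0`, `1` and the number of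
states, `23` tells whether MIN is the controller, and `24` collects the answer. -/

/-- For all triples in lexicographic order, do `body`. -/
def Prog.scan (body : Prog) : Prog :=
  .seq (.const 8 0) (.forLoop 7 22 (.seq (.seq (.readA 5 7) (.readB 2 7))
    (.forLoop 4 5 (.forLoop 1 2 (.seq body (.succ 8))))))

section Programs

variable {n : ℕ} {G : Game n} {I J : Finset (Fin n)}

theorem sum_const_add_two_le (L T : ℕ) (hL : 0 < L) :
    ∑ _i ∈ Finset.range L, (T + 2) + 2 ≤ L * (T + 4) := by
  simp only [Finset.sum_const, Finset.card_range, smul_eq_mul]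
  nlinarith

/-- The invariant depends only on the arrays and on the number of triples already visited. The body
may change only register `0` and the arrays, so the three counters and register `8` stay
synchronized with the lexicographic numbering. -/
theorem Runs.scan {body : Prog} {T : ℕ} {Inv : ℕ → (ℕ → ℕ → ℕ) → Prop} {s₀ : Memory}
    (hn : s₀.reg 22 = n) (h0 : Inv 0 s₀.arr)
    (hbody : ∀ (τ : G.Triple) (s : Memory), s.reg 7 = τ.1 → s.reg 4 = τ.2.1 → s.reg 1 = τ.2.2 →
      s.reg 8 = G.index τ → SameAbove 10 s₀ s → Inv (G.index τ) s.arr →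
        Runs G I J body s T fun s' => Inv (G.index τ + 1) s'.arr ∧ SameAbove 1 s s') :
    Runs G I J (.scan body) s₀ (G.m₂ * (T + 13) + 3) fun s' =>
      Inv G.m₂ s'.arr ∧ SameAbove 10 s₀ s' := by
  refine Runs.mono (T := 1 + (G.m₂ * (T + 13) + 2)) (Runs.seq (T := 1)
    (Q := fun s => s.reg 8 = 0 ∧ SameAbove 10 s₀ s ∧ s.arr = s₀.arr)
    (Runs.of_wp ⟨by simp, (SameAbove.refl 10 s₀).setReg (by norm_num) 0, rfl⟩ le_rfl)
    fun s hs => ?_) (by omega) fun _ h => h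
  obtain ⟨h8, hsame, harr⟩ := hs
  refine (Runs.forLoop (L := n)
    (Inv := fun i s => s.reg 8 = G.offset i ∧ SameAbove 10 s₀ s ∧ Inv (G.offset i) s.arr)
    (T := fun i => lookup G.numA i * lookup G.numB i * (T + 11)) (by norm_num)
    (by rw [hsame 22 (by norm_num), hn]) ?_ ?_ le_rfl).mono ?_ ?_
  · refine ⟨by simp [h8, Game.offset], hsame.setReg (by norm_num) _, ?_⟩
    simpa [Game.offset, harr] using h0
  · intro iv hi s h7 _ ⟨h8, hsame, hinv⟩
    obtain ⟨i, rfl⟩ : ∃ i : Fin n, (i : ℕ) = iv := ⟨⟨iv, hi⟩, rfl⟩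
    have hA := G.numA_pos i
    have hB := G.numB_pos i
    refine Runs.mono (T := 2 + G.numA i * (G.numB i * (T + 5) + 4)) (Runs.seq (T := 2)
      (Q := fun s => s.reg 7 = i ∧ s.reg 5 = G.numA i ∧ s.reg 2 = G.numB i ∧
        s.reg 8 = G.offset i ∧ SameAbove 10 s₀ s ∧ Inv (G.offset i) s.arr)
      (Runs.of_wp ?_ le_rfl) fun s hs => ?_) ?_ fun _ h => h
    · simp only [Prog.wp, Memory.setReg_reg, Memory.setReg_arr, h7, lookup_val]
      exact ⟨by simp, by simp, by simp [lookup_val], by simp [h8],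
        (hsame.setReg (by norm_num) _).setReg (by norm_num) _, hinv⟩
    · obtain ⟨h7, h5, h2, h8, hsame, hinv⟩ := hs
      refine (Runs.forLoop (L := G.numA i)
        (Inv := fun a s => s.reg 7 = i ∧ s.reg 2 = G.numB i ∧
          s.reg 8 = G.offset i + a * G.numB i ∧ SameAbove 10 s₀ s ∧
          Inv (G.offset i + a * G.numB i) s.arr)
        (T := fun _ => G.numB i * (T + 5)) (by norm_num) h5 ?_ ?_
        (sum_const_add_two_le _ _ hA)).mono le_rfl ?_
      · refine ⟨by simp [h7], by simp [h2], by simp [h8], hsame.setReg (by norm_num) _, ?_⟩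
        simpa using hinv
      · intro av ha s h4 h5 ⟨h7, h2, h8, hsame, hinv⟩
        obtain ⟨a, rfl⟩ : ∃ a : Fin (G.numA i), (a : ℕ) = av := ⟨⟨av, ha⟩, rfl⟩
        refine (Runs.forLoop (L := G.numB i)
          (Inv := fun b s => s.reg 7 = i ∧ s.reg 4 = a ∧ s.reg 5 = G.numA i ∧
            s.reg 8 = G.offset i + a * G.numB i + b ∧ SameAbove 10 s₀ s ∧
            s.reg 2 = G.numB i ∧ Inv (G.offset i + a * G.numB i + b) s.arr)
          (T := fun _ => T + 1) (by norm_num) h2 ?_ ?_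
          (sum_const_add_two_le _ _ hB)).mono le_rfl ?_
        · exact ⟨by simp [h7], by simp [h4], by simp [h5], by simp [h8],
            hsame.setReg (by norm_num) _, by simp [h2], hinv⟩
        · intro bv hb s h1 h2 ⟨h7, h4, h5, h8, hsame, _, hinv⟩
          obtain ⟨b, rfl⟩ : ∃ b : Fin (G.numB i), (b : ℕ) = bv := ⟨⟨bv, hb⟩, rfl⟩
          refine Runs.seq (hbody ⟨i, a, b⟩ s h7 h4 h1 h8 hsame hinv) fun s' hs' => ?_
          obtain ⟨hinv', hs'⟩ := hs'
          refine Runs.of_wp ?_ le_rfl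
          refine ⟨?_, ?_, ?_, ?_, ?_, ?_, ?_, ?_, hinv'⟩
          · simp [hs' 1, h1]
          · simp [hs' 2, h2]
          · simp [hs' 7, h7]
          · simp [hs' 4, h4]
          · simp [hs' 5, h5]
          · simp [hs' 8, h8, add_assoc]
          · exact ((hsame.trans (hs'.weaken (by norm_num))).setReg (by norm_num) _).setReg
              (by norm_num) _
          · simp [hs' 2, h2]
        · rintro s' ⟨h7, h4, h5, h8, hsame, h2, hinv⟩
          have e : G.offset i + a * G.numB i + G.numB i = G.offset i + (a + 1) * G.numB i := by
            ring
          rw [e] at h8 hinv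
          exact ⟨h4, h5, by simp [h7], by simp [h2], by simp [h8],
            hsame.setReg (by norm_num) _, hinv⟩
      · rintro s' ⟨h7, _, h8, hsame, hinv⟩
        rw [← G.offset_succ] at h8 hinv
        exact ⟨h7, by rw [hsame 22 (by norm_num), hn], by simp [h8],
          hsame.setReg (by norm_num) _, hinv⟩
    · rw [lookup_val, lookup_val]
      -- With both action sets nonempty, the overhead `4 * numA + 2` is at most `6 * numA * numB`.
      nlinarith [Nat.mul_pos hA hB, Nat.le_mul_of_pos_right (G.numA i) hB]
  · have h1 : ∀ i ∈ Finset.range n, lookup G.numA i * lookup G.numB i * (T + 11) + 2 ≤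
        lookup G.numA i * lookup G.numB i * (T + 13) := by
      intro i hi
      have hi' : i < n := Finset.mem_range.1 hi
      have := lookup_val G.numA ⟨i, hi'⟩
      have := lookup_val G.numB ⟨i, hi'⟩
      have := Nat.mul_pos (G.numA_pos ⟨i, hi'⟩) (G.numB_pos ⟨i, hi'⟩)
      simp only at *
      nlinarith
    have h2 := Finset.sum_le_sum h1
    rw [← Finset.sum_mul] at h2
    have h3 : ∑ i ∈ Finset.range n, lookup G.numA i * lookup G.numB i = G.m₂ := G.offset_card
    rw [h3] at h2
    omega
  · rintro s' ⟨_, hsame, hinv⟩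
    rw [G.offset_card] at hinv
    exact ⟨hinv, hsame⟩

/-- The test `pos` on registers holding a triple. -/
theorem holds_pos_iff (τ : G.Triple) {s : Memory} (h7 : s.reg 7 = τ.1) (h4 : s.reg 4 = τ.2.1)
    (h1 : s.reg 1 = τ.2.2) :
    (Test.pos 7 4 1 10).Holds G I J s ↔
      ∃ j : Fin n, (j : ℕ) = s.reg 10 ∧ 0 < G.prob τ.1 τ.2.1 τ.2.2 j := by
  obtain ⟨i, a, b⟩ := τ
  simp only [Test.Holds]
  constructor
  · rintro ⟨i', a', b', j, hi, ha, hb, hj, hp⟩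
    obtain rfl : i' = i := Fin.ext (hi.trans h7)
    obtain rfl : a' = a := Fin.ext (ha.trans h4)
    obtain rfl : b' = b := Fin.ext (hb.trans h1)
    exact ⟨j, hj, hp⟩
  · rintro ⟨j, hj, hp⟩
    exact ⟨i, a, b, j, h7.symm, h4.symm, h1.symm, hj, hp⟩

/-- In array `k`, mark the triples from which the state in register `10` is reached with positive
probability. -/
def Prog.mark (k : ℕ) : Prog :=
  .scan (.branch (.pos 7 4 1 10) (.store k 8 21) .skip)

/-- Old marks survive, so the flags can be updated incrementally. If register `10` holds no state,
every test fails and nothing is marked. -/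
theorem Runs.mark (k : ℕ) {s₀ : Memory} (hn : s₀.reg 22 = n) (h1 : s₀.reg 21 = 1)
    {R : G.Triple → Prop} (hR : G.CodesTriples (s₀.arr k) R) :
    Runs G I J (.mark k) s₀ (G.m₂ * 15 + 3) fun s' =>
      SameAbove 10 s₀ s' ∧ (∀ k', k' ≠ k → s'.arr k' = s₀.arr k') ∧
      G.CodesTriples (s'.arr k) fun τ =>
        R τ ∨ ∃ j : Fin n, (j : ℕ) = s₀.reg 10 ∧ 0 < G.prob τ.1 τ.2.1 τ.2.2 j := by
  refine (Runs.scan (T := 2) (Inv := fun m arr => (∀ k', k' ≠ k → arr k' = s₀.arr k') ∧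
    G.CodesTriples (arr k) fun τ => R τ ∨ (G.index τ < m ∧
      ∃ j : Fin n, (j : ℕ) = s₀.reg 10 ∧ 0 < G.prob τ.1 τ.2.1 τ.2.2 j)) hn ?_ ?_).mono le_rfl ?_
  · exact ⟨fun _ _ => rfl, fun τ => (hR τ).congr (by simp)⟩
  · intro τ s h7 h4 h1' h8 hsame ⟨hother, hcodes⟩
    refine Runs.of_wp ⟨fun hpos => ?_, fun hpos => ?_⟩ (by simp [Prog.cost])
    · rw [holds_pos_iff τ h7 h4 h1', hsame 10 le_rfl] at hpos
      refine ⟨⟨fun k' hk' => ?_, fun τ' => ?_⟩, SameAbove.refl _ _⟩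
      · simp [hk', hother k' hk']
      · simp only [Memory.setArr_arr, if_true, h8, hsame 21 (by norm_num), h1,
          Function.update_apply]
        by_cases hτ : τ' = τ
        · subst hτ
          simp only [if_true]
          exact codes_one (Or.inr ⟨Nat.lt_succ_self _, hpos⟩)
        · have hne : G.index τ' ≠ G.index τ := fun h => hτ (G.index_injective h)
          rw [if_neg hne]
          refine (hcodes τ').congr ?_
          have : G.index τ' < G.index τ ↔ G.index τ' < G.index τ + 1 := by omega
          simp only [this]
    · rw [holds_pos_iff τ h7 h4 h1', hsame 10 le_rfl] at hpos
      refine ⟨⟨hother, fun τ' => ?_⟩, SameAbove.refl _ _⟩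
      by_cases hτ : τ' = τ
      · subst hτ
        refine (hcodes τ').congr ?_
        simp only [hpos, and_false]
      · have hne : G.index τ' ≠ G.index τ := fun h => hτ (G.index_injective h)
        refine (hcodes τ').congr ?_
        have : G.index τ' < G.index τ ↔ G.index τ' < G.index τ + 1 := by omega
        simp only [this]
  · rintro s' ⟨⟨hother, hcodes⟩, hsame⟩
    exact ⟨hsame, hother, fun τ => (hcodes τ).congr (by simp [G.index_lt τ])⟩

/-- Initialize arrays `3` and `4` (of triples) from array `5` (of states) and by zero. -/
def Prog.initTriples : Prog :=
  .scan (.seq (.load 0 5 7) (.seq (.store 3 8 0) (.store 4 8 20)))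

theorem Runs.initTriples {s₀ : Memory} (hn : s₀.reg 22 = n) (h0 : s₀.reg 20 = 0)
    {T : Finset (Fin n)} (hT : CodesSet (s₀.arr 5) T) :
    Runs G I J .initTriples s₀ (G.m₂ * 16 + 3) fun s' =>
      SameAbove 10 s₀ s' ∧ (∀ k', k' ≠ 3 → k' ≠ 4 → s'.arr k' = s₀.arr k') ∧
      (G.CodesTriples (s'.arr 3) fun τ => τ.1 ∈ T) ∧
      G.CodesTriples (s'.arr 4) fun _ => False := by
  refine (Runs.scan (T := 3) (Inv := fun m arr =>
    (∀ k', k' ≠ 3 → k' ≠ 4 → arr k' = s₀.arr k') ∧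
    (∀ τ, G.index τ < m → Codes (arr 3 (G.index τ)) (τ.1 ∈ T)) ∧
    (∀ τ, G.index τ < m → Codes (arr 4 (G.index τ)) False)) hn ?_ ?_).mono le_rfl ?_
  · exact ⟨fun _ _ _ => rfl, fun τ h => absurd h (Nat.not_lt_zero _),
      fun τ h => absurd h (Nat.not_lt_zero _)⟩
  · intro τ s h7 h4 h1' h8 hsame ⟨hother, h3, h4⟩
    refine Runs.of_wp ?_ le_rfl
    simp only [Prog.wp]
    refine ⟨⟨fun k' hk3 hk4 => ?_, fun τ' hτ' => ?_, fun τ' hτ' => ?_⟩, ?_⟩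
    · simp [hk3, hk4, hother k' hk3 hk4]
    · by_cases hτ : τ' = τ
      · subst hτ
        simpa [h8, h7, hother 5] using hT τ'.1
      · have hne : G.index τ' ≠ G.index τ := fun h => hτ (G.index_injective h)
        simpa [h8, Function.update_apply, hne] using h3 τ' (by omega)
    · by_cases hτ : τ' = τ
      · subst hτ
        simpa [h8, hsame 20, h0] using codes_zero not_false
      · have hne : G.index τ' ≠ G.index τ := fun h => hτ (G.index_injective h)
        simpa [h8, Function.update_apply, hne] using h4 τ' (by omega)
    · exact (((SameAbove.refl 1 s).setReg (by norm_num) _).setArr _ _ _).setArr _ _ _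
  · rintro s' ⟨⟨hother, h3, h4⟩, hsame⟩
    exact ⟨hsame, hother, fun τ => h3 τ (G.index_lt τ), fun τ => h4 τ (G.index_lt τ)⟩

end Programs

/-! ### One step of the attractor computation -/

/-- Register `3` is updated by the truth value, at the triple numbered by register `8`, of being
marked in array `3` and not in array `4`: by conjunction if register `23` is `1` and by
disjunction if it is `0`. -/
def Prog.evalTriple : Prog :=
  .seq (.load 0 3 8) (.seq (.load 9 4 8) (.seq (.branch (.eq 9 21) (.copy 0 20) .skip)
    -- Register `23` holds the neutral element of the operation: an equal value leaves the
    -- accumulator alone, a different one is absorbing and replaces it.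
    (.seq (.branch (.eq 0 23) .skip (.copy 3 0)) (.succ 8))))

/-- Array `1` becomes the set of states from which the controller can choose a triple that is
marked in array `3` and not in array `4`. -/
def Prog.update : Prog :=
  .seq (.const 8 0) (.forLoop 7 22 (.seq
    (.seq (.seq (.readA 5 7) (.readB 2 7)) (.branch (.eq 23 21) (.copy 6 20) (.copy 6 21)))
    (.seq (.forLoop 4 5 (.seq (.copy 3 23)
      -- The outer quantifier is opposite to the inner one, so `23` holds its absorbing value;
      -- register `6` starts from the other value.
      (.seq (.forLoop 1 2 .evalTriple) (.branch (.eq 3 23) (.copy 6 23) .skip))))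
      (.store 1 7 6))))

/-- Conjunction over `k < m` if `c` holds, and disjunction otherwise. -/
def BoundedAll (c : Bool) (m : ℕ) (P : ℕ → Prop) : Prop :=
  if c then ∀ k < m, P k else ∃ k < m, P k

theorem boundedAll_zero (c : Bool) (P : ℕ → Prop) : BoundedAll c 0 P ↔ c = true := by
  cases c <;> simp [BoundedAll]

theorem boundedAll_succ (c : Bool) (m : ℕ) (P : ℕ → Prop) :
    BoundedAll c (m + 1) P ↔ if c then BoundedAll c m P ∧ P m else BoundedAll c m P ∨ P m := by
  cases c
  · simp only [BoundedAll, Bool.false_eq_true, if_false]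
    exact Nat.exists_lt_succ_right
  · simp only [BoundedAll, if_true]
    exact Nat.forall_lt_succ_right

theorem quant_iff_boundedAll {A B : ℕ} (c : Bool) (Q : ℕ → ℕ → Prop) :
    BoundedAll (!c) A (fun a => BoundedAll c B (Q a)) ↔
      Quant c fun (a : Fin A) (b : Fin B) => Q a b := by
  cases c
  · simp only [BoundedAll, Quant, Fin.forall_iff, Fin.exists_iff]
    simp
  · simp only [BoundedAll, Quant, Fin.forall_iff, Fin.exists_iff]
    simp

section Update

variable {n : ℕ} {G : Game n} {I J : Finset (Fin n)}

theorem Runs.evalTriple {c : Bool} {s : Memory} (h20 : s.reg 20 = 0) (h21 : s.reg 21 = 1)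
    (h23 : s.reg 23 = c.toNat) {H B P : Prop} (hH : Codes (s.arr 3 (s.reg 8)) H)
    (hB : Codes (s.arr 4 (s.reg 8)) B) (hP : Codes (s.reg 3) P) :
    Runs G I J .evalTriple s 7 fun s' =>
      Codes (s'.reg 3) (if c then P ∧ (H ∧ ¬ B) else P ∨ (H ∧ ¬ B)) ∧
      s'.reg 8 = s.reg 8 + 1 ∧ s'.arr = s.arr ∧
      ∀ r, r ≠ 0 → r ≠ 3 → r ≠ 8 → r ≠ 9 → s'.reg r = s.reg r := by
  refine Runs.of_wp ?_ (by simp [Prog.evalTriple, Prog.cost])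
  simp only [Prog.evalTriple, Prog.wp, Test.Holds, Memory.setReg_reg, Memory.setReg_arr]
  rcases hH with ⟨hH, hH'⟩ | ⟨hH, hH'⟩ <;> rcases hB with ⟨hB, hB'⟩ | ⟨hB, hB'⟩ <;>
    rcases hP with ⟨hP, hP'⟩ | ⟨hP, hP'⟩ <;> cases c <;>
    simp [hH, hH', hB, hB', hP, hP', h20, h21, h23, Codes] <;>
    intro r h0 h3 h8 h9 <;> simp [h0, h3, h8, h9]

/-- Register `3` accumulates the inner quantifier over the replies seen so far, and register `6` the
outer one. Only the stored flags are read, so the pass costs `O(m₂)` without any probability test.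
-/
theorem Runs.update {c : Bool} {s₀ : Memory} (hn : s₀.reg 22 = n) (h20 : s₀.reg 20 = 0)
    (h21 : s₀.reg 21 = 1) (h23 : s₀.reg 23 = c.toNat) {H B : G.Triple → Prop}
    (hH : G.CodesTriples (s₀.arr 3) H) (hB : G.CodesTriples (s₀.arr 4) B) {X : Finset (Fin n)}
    (hX : ∀ i, i ∈ X ↔ Quant c fun a b => H ⟨i, a, b⟩ ∧ ¬ B ⟨i, a, b⟩) :
    Runs G I J .update s₀ (G.m₂ * 34 + 3) fun s' =>
      SameAbove 10 s₀ s' ∧ (∀ k, k ≠ 1 → s'.arr k = s₀.arr k) ∧ CodesSet (s'.arr 1) X := by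
  classical
  -- The condition on triples is extended to natural numbers, so that partially executed loops are
  -- described by `BoundedAll` without dependent types.
  let Q : ℕ → ℕ → ℕ → Prop := fun i a b =>
    ∃ τ : G.Triple, (τ.1 : ℕ) = i ∧ (τ.2.1 : ℕ) = a ∧ (τ.2.2 : ℕ) = b ∧ H τ ∧ ¬ B τ
  have hQ : ∀ (i : Fin n) (a : Fin (G.numA i)) (b : Fin (G.numB i)),
      Q i a b ↔ H ⟨i, a, b⟩ ∧ ¬ B ⟨i, a, b⟩ := by
    intro i a b
    constructor
    · rintro ⟨⟨i', a', b'⟩, hi, ha, hb, h⟩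
      obtain rfl : i' = i := Fin.ext hi
      obtain rfl : a' = a := Fin.ext ha
      obtain rfl : b' = b := Fin.ext hb
      exact h
    · exact fun h => ⟨⟨i, a, b⟩, rfl, rfl, rfl, h⟩
  let E : Fin n → ℕ → Prop := fun i m =>
    BoundedAll (!c) m fun a => BoundedAll c (G.numB i) (Q i a)
  have hXE : ∀ i, i ∈ X ↔ E i (G.numA i) := fun i => by
    rw [hX]
    simp only [← hQ]
    exact (quant_iff_boundedAll c (Q i)).symm
  refine Runs.mono (T := 1 + (G.m₂ * 34 + 2)) (Runs.seq (T := 1)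
    (Q := fun s => s.reg 8 = 0 ∧ SameAbove 10 s₀ s ∧ s.arr = s₀.arr)
    (Runs.of_wp ⟨by simp, (SameAbove.refl 10 s₀).setReg (by norm_num) 0, rfl⟩ le_rfl)
    fun s hs => ?_) (by omega) fun _ h => h
  obtain ⟨h8, hsame, harr⟩ := hs
  refine (Runs.forLoop (L := n)
    (Inv := fun i s => s.reg 8 = G.offset i ∧ SameAbove 10 s₀ s ∧
      (∀ k, k ≠ 1 → s.arr k = s₀.arr k) ∧
      ∀ j : Fin n, (j : ℕ) < i → Codes (s.arr 1 j) (j ∈ X))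
    (T := fun i => lookup G.numA i * lookup G.numB i * 32) (by norm_num)
    (by rw [hsame 22 (by norm_num), hn]) ?_ ?_ le_rfl).mono ?_ ?_
  · exact ⟨by simp [h8, Game.offset], hsame.setReg (by norm_num) _, fun k _ => by simp [harr],
      fun j hj => absurd hj (Nat.not_lt_zero _)⟩
  · intro iv hi s h7 _ ⟨h8, hsame, hother, hX1⟩
    obtain ⟨i, rfl⟩ : ∃ i : Fin n, (i : ℕ) = iv := ⟨⟨iv, hi⟩, rfl⟩
    have hA := G.numA_pos i
    have hB' := G.numB_pos i
    refine Runs.mono (T := 4 + (G.numA i * (1 + (G.numB i * 11 + 2) + 4) + 1))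
      (Runs.seq (T := 4)
      (Q := fun s' => s'.reg 7 = i ∧ s'.reg 5 = G.numA i ∧ s'.reg 2 = G.numB i ∧
        s'.reg 8 = G.offset i ∧ Codes (s'.reg 6) (E i 0) ∧ SameAbove 10 s₀ s' ∧ s'.arr = s.arr)
      (Runs.of_wp ?_ le_rfl) fun s' hs' => Runs.seq (Q := fun s' =>
        s'.reg 7 = i ∧ s'.reg 8 = G.offset (i + 1) ∧ Codes (s'.reg 6) (E i (G.numA i)) ∧
          SameAbove 10 s₀ s' ∧ s'.arr = s.arr) ?_ fun s'' hs'' => ?_) ?_ fun _ h => h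
    · simp only [Prog.wp, Memory.setReg_reg, Memory.setReg_arr, h7, lookup_val]
      have hs' : ∀ x y z : ℕ, SameAbove 10 s₀ (((s.setReg 5 x).setReg 2 y).setReg 6 z) :=
        fun x y z => ((hsame.setReg (by norm_num) _).setReg (by norm_num) _).setReg
          (by norm_num) _
      have e20 : s.reg 20 = 0 := (hsame 20 (by norm_num)).trans h20
      have e21 : s.reg 21 = 1 := (hsame 21 (by norm_num)).trans h21
      have e23 : s.reg 23 = c.toNat := (hsame 23 (by norm_num)).trans h23
      constructor
      · intro h
        refine ⟨by simp, by simp, by simp [lookup_val], by simp [h8], ?_, hs' _ _ _, trivial⟩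
        simp only [Test.Holds, Memory.setReg_reg] at h
        simp only [E, boundedAll_zero]
        simp [e20, Codes]
        cases c <;> simp_all
      · intro h
        refine ⟨by simp, by simp, by simp [lookup_val], by simp [h8], ?_, hs' _ _ _, trivial⟩
        simp only [Test.Holds, Memory.setReg_reg] at h
        simp only [E, boundedAll_zero]
        simp [e21, Codes]
        cases c <;> simp_all
    · obtain ⟨h7, h5, h2, h8, h6, hsame', harr'⟩ := hs'
      refine (Runs.forLoop (L := G.numA i)
        (Inv := fun a s' => s'.reg 7 = i ∧ s'.reg 2 = G.numB i ∧
          s'.reg 8 = G.offset i + a * G.numB i ∧ Codes (s'.reg 6) (E i a) ∧ SameAbove 10 s₀ s' ∧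
          s'.arr = s.arr)
        (T := fun _ => 1 + (G.numB i * 11 + 2)) (by norm_num) h5 ?_ ?_
        (sum_const_add_two_le _ _ hA)).mono le_rfl ?_
      · exact ⟨by simp [h7], by simp [h2], by simp [h8], by simpa using h6,
          hsame'.setReg (by norm_num) _, harr'⟩
      · intro av ha s₁ h4 h5 ⟨h7, h2, h8, h6, hsame₁, harr₁⟩
        obtain ⟨a, rfl⟩ : ∃ a : Fin (G.numA i), (a : ℕ) = av := ⟨⟨av, ha⟩, rfl⟩
        refine Runs.seq (Q := fun s' => s'.reg 4 = a ∧ s'.reg 5 = G.numA i ∧ s'.reg 7 = i ∧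
          s'.reg 2 = G.numB i ∧ s'.reg 8 = G.offset i + a * G.numB i ∧ Codes (s'.reg 6) (E i a) ∧
          Codes (s'.reg 3) (BoundedAll c 0 (Q i a)) ∧ SameAbove 10 s₀ s' ∧ s'.arr = s.arr)
          (Runs.of_wp ?_ le_rfl) fun s₂ hs₂ => Runs.seq (Q := fun s' => s'.reg 4 = a ∧
            s'.reg 5 = G.numA i ∧ s'.reg 7 = i ∧ s'.reg 2 = G.numB i ∧
            s'.reg 8 = G.offset i + (a + 1) * G.numB i ∧ Codes (s'.reg 6) (E i a) ∧
            Codes (s'.reg 3) (BoundedAll c (G.numB i) (Q i a)) ∧ SameAbove 10 s₀ s' ∧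
            s'.arr = s.arr) ?_ fun s₃ hs₃ => Runs.of_wp ?_ le_rfl
        · refine ⟨by simp [h4], by simp [h5], by simp [h7], by simp [h2], by simp [h8],
            by simpa using h6, ?_, hsame₁.setReg (by norm_num) _, harr₁⟩
          rw [boundedAll_zero]
          simp only [Memory.setReg_reg, if_true]
          rw [hsame₁ 23 (by norm_num), h23]
          cases c <;> simp [Codes]
        · obtain ⟨h4, h5, h7, h2, h8, h6, h3, hsame₂, harr₂⟩ := hs₂
          refine (Runs.forLoop (L := G.numB i)
            (Inv := fun b s' => s'.reg 4 = a ∧ s'.reg 5 = G.numA i ∧ s'.reg 7 = i ∧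
              s'.reg 2 = G.numB i ∧ s'.reg 8 = G.offset i + a * G.numB i + b ∧
              Codes (s'.reg 6) (E i a) ∧ Codes (s'.reg 3) (BoundedAll c b (Q i a)) ∧
              SameAbove 10 s₀ s' ∧ s'.arr = s.arr)
            (T := fun _ => 7) (by norm_num) h2 ?_ ?_
            (sum_const_add_two_le _ _ hB')).mono le_rfl ?_
          · exact ⟨by simp [h4], by simp [h5], by simp [h7], by simp [h2], by simp [h8],
              by simpa using h6, by simpa using h3, hsame₂.setReg (by norm_num) _, harr₂⟩
          · intro bv hb s₃ h1 h2 ⟨h4, h5, h7, _, h8, h6, h3, hsame₃, harr₃⟩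
            obtain ⟨b, rfl⟩ : ∃ b : Fin (G.numB i), (b : ℕ) = bv := ⟨⟨bv, hb⟩, rfl⟩
            have hH3 := hH ⟨i, a, b⟩
            have hB4 := hB ⟨i, a, b⟩
            rw [← hother 3 (by norm_num), ← harr₃] at hH3
            rw [← hother 4 (by norm_num), ← harr₃] at hB4
            have hidx : s₃.reg 8 = G.index ⟨i, a, b⟩ := h8
            rw [← hidx] at hH3 hB4
            refine (Runs.evalTriple (c := c) ((hsame₃ 20 (by norm_num)).trans h20)
              ((hsame₃ 21 (by norm_num)).trans h21) ((hsame₃ 23 (by norm_num)).trans h23)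
              hH3 hB4 h3).mono le_rfl ?_
            rintro s₄ ⟨h3', h8', harr₄, hfr⟩
            refine ⟨by simp [hfr, h1], by simp [hfr, h2], by simp [hfr, h4], by simp [hfr, h5],
              by simp [hfr, h7], by simp [hfr, h2], by simp [h8', h8, add_assoc],
              by simpa [hfr] using h6, ?_, ?_, harr₄.trans harr₃⟩
            · rw [boundedAll_succ, hQ]
              simpa using h3'
            · refine SameAbove.setReg (fun r hr => ?_) (by norm_num) _
              rw [hfr r (by omega) (by omega) (by omega) (by omega), hsame₃ r hr]
          · rintro s₃ ⟨h4, h5, h7, h2, h8, h6, h3, hsame₃, harr₃⟩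
            exact ⟨h4, h5, h7, h2, by rw [h8]; ring, h6, h3, hsame₃, harr₃⟩
        · obtain ⟨h4, h5, h7, h2, h8, h6, h3, hsame₃, harr₃⟩ := hs₃
          have e23 : s₃.reg 23 = c.toNat := (hsame₃ 23 (by norm_num)).trans h23
          have hE : E i (a + 1) ↔ if !c then E i a ∧ BoundedAll c (G.numB i) (Q i a)
              else E i a ∨ BoundedAll c (G.numB i) (Q i a) := boundedAll_succ _ _ _
          refine ⟨fun h => ?_, fun h => ?_⟩
          · refine ⟨by simp [h4], by simp [h5], by simp [h7], by simp [h2], by simp [h8], ?_,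
              (hsame₃.setReg (by norm_num) _).setReg (by norm_num) _, harr₃⟩
            simp only [Test.Holds, e23] at h
            simp only [Memory.setReg_reg]
            rw [h] at h3
            cases c
            · simpa [e23, Codes, hE] using fun _ => h3.eq_zero_iff.1 rfl
            · simpa [e23, Codes, hE] using Or.inr (h3.eq_one_iff.1 rfl)
          · refine ⟨by simp [h4], by simp [h5], by simp [h7], by simp [h2], by simp [h8], ?_,
              hsame₃.setReg (by norm_num) _, harr₃⟩
            simp only [Test.Holds, e23] at h
            simp only [Memory.setReg_reg]
            refine Codes.congr (by simpa using h6) ?_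
            rw [hE]
            cases c
            · rw [Bool.toNat_false, h3.eq_zero_iff, not_not] at h
              simp [h]
            · rw [Bool.toNat_true, h3.eq_one_iff] at h
              simp [h]
      · rintro s₁ ⟨h7, h2, h8, h6, hsame₁, harr₁⟩
        exact ⟨h7, by rw [h8, G.offset_succ], h6, hsame₁, harr₁⟩
    · obtain ⟨h7, h8, h6, hsame₁, harr₁⟩ := hs''
      refine Runs.of_wp ?_ le_rfl
      refine ⟨by simp [h7], by simp [hsame₁ 22, hn], by simp [h8],
        (hsame₁.setArr _ _ _).setReg (by norm_num) _, fun k hk => ?_, fun j hj => ?_⟩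
      · simp [hk, harr₁, hother k hk]
      · simp only [Memory.setReg_arr, Memory.setArr_arr, if_true, h7, Function.update_apply]
        by_cases hij : j = i
        · subst hij
          simp only [if_true]
          exact h6.congr (hXE j).symm
        · have hne : (j : ℕ) ≠ i := fun h => hij (Fin.ext h)
          rw [if_neg hne, harr₁]
          exact hX1 j (by omega)
    · rw [lookup_val, lookup_val]
      nlinarith [Nat.mul_pos hA hB', Nat.le_mul_of_pos_right (G.numA i) hB']
  · have h1 : ∀ i ∈ Finset.range n, lookup G.numA i * lookup G.numB i * 32 + 2 ≤
        lookup G.numA i * lookup G.numB i * 34 := by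
      intro i hi
      have hi' : i < n := Finset.mem_range.1 hi
      have := lookup_val G.numA ⟨i, hi'⟩
      have := lookup_val G.numB ⟨i, hi'⟩
      have := Nat.mul_pos (G.numA_pos ⟨i, hi'⟩) (G.numB_pos ⟨i, hi'⟩)
      simp only at *
      nlinarith
    have h2 := Finset.sum_le_sum h1
    rw [← Finset.sum_mul] at h2
    have h3 : ∑ i ∈ Finset.range n, lookup G.numA i * lookup G.numB i = G.m₂ := G.offset_card
    rw [h3] at h2
    omega
  · rintro s' ⟨_, hsame, hother, hX1⟩
    exact ⟨hsame, hother, fun j => hX1 j j.2⟩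

end Update

/-! ### The nested attractor computation

Arrays of states: `0` holds the current set of safe states, `1` the current attractor, `2` the
states whose predecessors have been marked, `5` the target. -/

/-- Register `10` becomes a state in array `1` that is not in array `2`, or the number of states
if there is none. -/
def Prog.pick : Prog :=
  .seq (.copy 10 22) (.forLoop 7 22 (.seq (.load 0 1 7) (.branch (.eq 0 21)
    (.seq (.load 0 2 7) (.branch (.eq 0 20) (.copy 10 7) .skip)) .skip)))

/-- Process one more state of the attractor. -/
def Prog.attrStep : Prog :=
  .seq .pick (.seq (.store 2 10 21) (.seq (.mark 3) .update))

/-- In array `4`, mark the triples that may lead outside of the set in array `0`. -/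
def Prog.markOutside : Prog :=
  .forLoop 10 22 (.seq (.load 0 0 10) (.branch (.eq 0 20) (.mark 4) .skip))

/-- The set in array `0` is replaced by its attractor. -/
def Prog.coreStep : Prog :=
  .seq (.forLoop 7 22 (.store 2 7 20)) (.seq .initTriples (.seq .markOutside (.seq .update
    (.seq (.forLoop 11 22 .attrStep)
      (.forLoop 7 22 (.seq (.load 0 1 7) (.store 0 7 0)))))))

/-- Register `24` becomes `0` if the core differs from the set of states satisfying `t`. -/
def Prog.checkCore (t : Test) : Prog :=
  .seq (.forLoop 7 22 (.branch t (.store 5 7 21) (.store 5 7 20)))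
    (.seq (.forLoop 7 22 (.store 0 7 21)) (.seq (.forLoop 12 22 .coreStep)
      (.forLoop 7 22 (.seq (.load 0 0 7) (.seq (.load 9 5 7)
        (.branch (.eq 0 9) .skip (.copy 24 20)))))))

/-! ### Correctness and cost of the nested attractor computation. -/

section Core

variable {n : ℕ} {G : Game n} {I J : Finset (Fin n)}

theorem Runs.branch {t : Test} {p q : Prog} {s : Memory} {T : ℕ} {Q : Memory → Prop}
    (h : t.Holds G I J s → Runs G I J p s T Q) (h' : ¬ t.Holds G I J s → Runs G I J q s T Q) :
    Runs G I J (.branch t p q) s (T + 1) Q := by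
  by_cases ht : t.Holds G I J s
  · obtain ⟨k, hk, s', he, hq⟩ := h ht
    exact ⟨k + 1, Nat.succ_le_succ hk, s', he.branch_true ht, hq⟩
  · obtain ⟨k, hk, s', he, hq⟩ := h' ht
    exact ⟨k + 1, Nat.succ_le_succ hk, s', he.branch_false ht, hq⟩

/-- A loop over the states that fills array `k` with a set. -/
theorem Runs.fill {body : Prog} {T k : ℕ} {S : Finset (Fin n)} {s₀ : Memory} (hn0 : 0 < n)
    (hn : s₀.reg 22 = n)
    (hbody : ∀ (i : Fin n) (s : Memory), s.reg 7 = i → SameAbove 10 s₀ s →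
      (∀ k', k' ≠ k → s.arr k' = s₀.arr k') →
      Runs G I J body s T fun s' => (∃ v, Codes v (i ∈ S) ∧
        s'.arr k = Function.update (s.arr k) i v) ∧ (∀ k', k' ≠ k → s'.arr k' = s.arr k') ∧
        SameAbove 1 s s') :
    Runs G I J (.forLoop 7 22 body) s₀ (n * (T + 4)) fun s' =>
      SameAbove 10 s₀ s' ∧ (∀ k', k' ≠ k → s'.arr k' = s₀.arr k') ∧ CodesSet (s'.arr k) S := by
  refine (Runs.forLoop (L := n) (Inv := fun i s => SameAbove 10 s₀ s ∧
    (∀ k', k' ≠ k → s.arr k' = s₀.arr k') ∧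
      ∀ j : Fin n, (j : ℕ) < i → Codes (s.arr k j) (j ∈ S))
    (T := fun _ => T) (by norm_num) hn ?_ ?_ (sum_const_add_two_le _ _ hn0)).mono le_rfl ?_
  · exact ⟨(SameAbove.refl 10 s₀).setReg (by norm_num) _, fun _ _ => rfl,
      fun j hj => absurd hj (Nat.not_lt_zero _)⟩
  · intro iv hi s h7 h22 ⟨hsame, hother, hS⟩
    obtain ⟨i, rfl⟩ : ∃ i : Fin n, (i : ℕ) = iv := ⟨⟨iv, hi⟩, rfl⟩
    refine (hbody i s h7 hsame hother).mono le_rfl ?_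
    rintro s' ⟨⟨v, hv, harr⟩, hother', hs'⟩
    refine ⟨by rw [hs' 7 (by norm_num), h7], by rw [hs' 22 (by norm_num), h22],
      (hsame.trans (hs'.weaken (by norm_num))).setReg (by norm_num) _,
      fun k' hk' => (hother' k' hk').trans (hother k' hk'), fun j hj => ?_⟩
    simp only [Memory.setReg_arr, harr, Function.update_apply]
    by_cases hij : j = i
    · subst hij; simpa using hv
    · have hne : (j : ℕ) ≠ i := fun h => hij (Fin.ext h)
      rw [if_neg hne]
      exact hS j (by omega)
  · rintro s' ⟨hsame, hother, hS⟩
    exact ⟨hsame, hother, fun j => hS j j.2⟩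

/-- The value `n` serves as a sentinel for the absence of an unprocessed state; otherwise later
candidates overwrite earlier ones. -/
theorem Runs.pick {s₀ : Memory} (hn0 : 0 < n) (hn : s₀.reg 22 = n) (h20 : s₀.reg 20 = 0)
    (h21 : s₀.reg 21 = 1) {Y D : Finset (Fin n)} (hY : CodesSet (s₀.arr 1) Y)
    (hD : CodesSet (s₀.arr 2) D) :
    Runs G I J .pick s₀ (n * 9 + 1) fun s' => SameAbove 11 s₀ s' ∧ s'.arr = s₀.arr ∧
      ((∃ j : Fin n, s'.reg 10 = j ∧ j ∈ Y ∧ j ∉ D) ∨ (s'.reg 10 = n ∧ Y ⊆ D)) := by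
  refine Runs.mono (T := 1 + n * 9) (Runs.seq (T := 1)
    (Q := fun s => s.reg 10 = n ∧ SameAbove 11 s₀ s ∧ s.arr = s₀.arr)
    (Runs.of_wp ⟨by simp [hn], (SameAbove.refl 11 s₀).setReg (by norm_num) _, rfl⟩ le_rfl)
    fun s hs => ?_) (by omega) fun _ h => h
  obtain ⟨h10, hsame, harr⟩ := hs
  refine (Runs.forLoop (L := n) (Inv := fun i s => SameAbove 11 s₀ s ∧ s.arr = s₀.arr ∧
    ((∃ j : Fin n, s.reg 10 = j ∧ j ∈ Y ∧ j ∉ D) ∨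
      (s.reg 10 = n ∧ ∀ j : Fin n, (j : ℕ) < i → j ∈ Y → j ∈ D)))
    (T := fun _ => 5) (by norm_num) (by rw [hsame 22 (by norm_num), hn]) ?_ ?_
    (sum_const_add_two_le _ _ hn0)).mono le_rfl ?_
  · exact ⟨hsame.setReg (by norm_num) _, harr, Or.inr ⟨by simp [h10],
      fun j hj => absurd hj (Nat.not_lt_zero _)⟩⟩
  · intro iv hi s h7 h22 ⟨hsame, harr, hj⟩
    obtain ⟨i, rfl⟩ : ∃ i : Fin n, (i : ℕ) = iv := ⟨⟨iv, hi⟩, rfl⟩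
    have hYi := hY i
    have hDi := hD i
    have keep : (i ∈ Y → i ∈ D) → (∃ j : Fin n, s.reg 10 = j ∧ j ∈ Y ∧ j ∉ D) ∨
        (s.reg 10 = n ∧ ∀ j : Fin n, (j : ℕ) < i + 1 → j ∈ Y → j ∈ D) := fun h => by
      refine hj.imp_right fun ⟨h10, hall⟩ => ⟨h10, fun j hlt => ?_⟩
      rcases (Nat.lt_succ_iff_lt_or_eq.1 hlt) with hlt | heq
      · exact hall j hlt
      · obtain rfl : j = i := Fin.ext heq
        exact h
    refine Runs.of_wp ?_ (by simp [Prog.cost])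
    simp only [Prog.wp, Test.Holds]
    refine ⟨fun h1 => ⟨fun h2 => ?_, fun h2 => ?_⟩, fun h1 => ?_⟩
    · refine ⟨by simp [h7], by simp [h22], (((hsame.setReg (by norm_num) _).setReg
        (by norm_num) _).setReg (by norm_num) _).setReg (by norm_num) _, harr, Or.inl ⟨i, ?_⟩⟩
      simp [h7, harr, hsame 20, hsame 21, h20, h21] at h1 h2
      exact ⟨by simp [h7], hYi.eq_one_iff.1 h1, hDi.eq_zero_iff.1 h2⟩
    · refine ⟨by simp [h7], by simp [h22], ((hsame.setReg (by norm_num) _).setReg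
        (by norm_num) _).setReg (by norm_num) _, harr, ?_⟩
      simp [h7, harr, hsame 20, h20, hDi.eq_zero_iff] at h2
      simpa using keep fun _ => h2
    · refine ⟨by simp [h7], by simp [h22], (hsame.setReg (by norm_num) _).setReg
        (by norm_num) _, harr, ?_⟩
      simp [h7, harr, hsame 21, h21, hYi.eq_one_iff] at h1
      simpa using keep fun h => absurd h h1
  · rintro s' ⟨hsame, harr, hj⟩
    exact ⟨hsame, harr, hj.imp_right fun ⟨h10, hall⟩ => ⟨h10, fun j => hall j j.2⟩⟩

theorem Runs.markOutside {s₀ : Memory} (hn0 : 0 < n) (hn : s₀.reg 22 = n)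
    (h20 : s₀.reg 20 = 0) (h21 : s₀.reg 21 = 1) {X : Finset (Fin n)}
    (hX : CodesSet (s₀.arr 0) X) (h4 : G.CodesTriples (s₀.arr 4) fun _ => False) :
    Runs G I J .markOutside s₀ (n * (G.m₂ * 15 + 9)) fun s' =>
      SameAbove 11 s₀ s' ∧ (∀ k, k ≠ 4 → s'.arr k = s₀.arr k) ∧
      G.CodesTriples (s'.arr 4) fun τ => ∃ j, j ∉ X ∧ 0 < G.prob τ.1 τ.2.1 τ.2.2 j := by
  refine (Runs.forLoop (L := n) (Inv := fun i s => SameAbove 11 s₀ s ∧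
    (∀ k, k ≠ 4 → s.arr k = s₀.arr k) ∧ G.CodesTriples (s.arr 4) fun τ =>
      ∃ j : Fin n, (j : ℕ) < i ∧ j ∉ X ∧ 0 < G.prob τ.1 τ.2.1 τ.2.2 j)
    (T := fun _ => 1 + (G.m₂ * 15 + 3 + 1)) (by norm_num) hn ?_ ?_
    (sum_const_add_two_le _ _ hn0)).mono (Nat.mul_le_mul_left _ (by omega)) ?_
  · exact ⟨(SameAbove.refl 11 s₀).setReg (by norm_num) _, fun _ _ => rfl,
      fun τ => (h4 τ).congr (by simp)⟩
  · intro iv hi s h10 h22 ⟨hsame, hother, hcodes⟩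
    obtain ⟨i, rfl⟩ : ∃ i : Fin n, (i : ℕ) = iv := ⟨⟨iv, hi⟩, rfl⟩
    have hXi := hX i
    refine Runs.seq (Q := fun s' => s'.reg 10 = i ∧ Codes (s'.reg 0) (i ∈ X) ∧
      SameAbove 11 s₀ s' ∧ s'.arr = s.arr) (Runs.of_wp ?_ le_rfl) fun s₁ hs₁ => ?_
    · refine ⟨by simp [h10], ?_, hsame.setReg (by norm_num) _, rfl⟩
      simpa [h10, hother 0] using hXi
    · obtain ⟨h10, h0, hsame₁, harr₁⟩ := hs₁
      have e20 : s₁.reg 20 = 0 := (hsame₁ 20 (by norm_num)).trans h20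
      have e21 : s₁.reg 21 = 1 := (hsame₁ 21 (by norm_num)).trans h21
      have e22 : s₁.reg 22 = n := (hsame₁ 22 (by norm_num)).trans hn
      have step : ∀ j : Fin n, (j : ℕ) < i + 1 ↔ (j : ℕ) < i ∨ j = i := fun j => by
        rw [Fin.ext_iff]; omega
      refine Runs.branch (fun h => ?_) fun h => ?_
      · simp only [Test.Holds, e20, h0.eq_zero_iff] at h
        refine (Runs.mark 4 e22 e21 (by rw [harr₁]; exact hcodes)).mono le_rfl ?_
        rintro s₂ ⟨hsame₂, hother₂, hcodes₂⟩
        refine ⟨by rw [hsame₂ 10 le_rfl, h10], by rw [hsame₂ 22 (by norm_num), e22],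
          (hsame₁.trans (hsame₂.weaken (by norm_num))).setReg (by norm_num) _,
          fun k hk => (hother₂ k hk).trans ((congrFun harr₁ k).trans (hother k hk)),
          fun τ => (hcodes₂ τ).congr ?_⟩
        constructor
        · rintro (⟨j, hj, hjX, hp⟩ | ⟨j, hj, hp⟩)
          · exact ⟨j, by omega, hjX, hp⟩
          · obtain rfl : j = i := Fin.ext (hj.trans h10)
            exact ⟨j, by omega, h, hp⟩
        · rintro ⟨j, hj, hjX, hp⟩
          rcases (step j).1 hj with hj | rfl
          · exact Or.inl ⟨j, hj, hjX, hp⟩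
          · exact Or.inr ⟨j, h10.symm, hp⟩
      · simp only [Test.Holds, e20, h0.eq_zero_iff, not_not] at h
        refine Runs.of_wp ?_ (by simp [Prog.cost])
        refine ⟨h10, e22, hsame₁.setReg (by norm_num) _,
          fun k hk => (congrFun harr₁ k).trans (hother k hk), fun τ => ?_⟩
        rw [Memory.setReg_arr, harr₁]
        refine (hcodes τ).congr ⟨fun ⟨j, hj, h'⟩ => ⟨j, by omega, h'⟩, ?_⟩
        rintro ⟨j, hj, hjX, hp⟩
        rcases (step j).1 hj with hj | rfl
        · exact ⟨j, hj, hjX, hp⟩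
        · exact absurd h hjX
  · rintro s' ⟨hsame, hother, hcodes⟩
    exact ⟨hsame, hother, fun τ => (hcodes τ).congr ⟨fun ⟨j, _, h⟩ => ⟨j, h⟩,
      fun ⟨j, h⟩ => ⟨j, j.2, h⟩⟩⟩

/-- The triples that are good for reaching `T`, or `D` in one step. -/
def Game.Hits (G : Game n) (T D : Finset (Fin n)) (τ : G.Triple) : Prop :=
  τ.1 ∈ T ∨ ∃ j ∈ D, 0 < G.prob τ.1 τ.2.1 τ.2.2 j

/-- The triples that may lead outside of `X`. -/
def Game.Leaves (G : Game n) (X : Finset (Fin n)) (τ : G.Triple) : Prop :=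
  ∃ j, j ∉ X ∧ 0 < G.prob τ.1 τ.2.1 τ.2.2 j

/-- The state of the attractor computation after the states of `D` have been processed. -/
structure AttrState (G : Game n) (c : Bool) (T X D : Finset (Fin n)) (s : Memory) : Prop where
  done : CodesSet (s.arr 2) D
  hits : G.CodesTriples (s.arr 3) (G.Hits T D)
  leaves : G.CodesTriples (s.arr 4) (G.Leaves X)
  attr : CodesSet (s.arr 1) (G.pre c T X D)

/-- One more processed state changes only the flags of triples that hit it, so one marking pass and
one evaluation pass restore the whole state. -/
theorem Runs.attrStep {c : Bool} {T X D : Finset (Fin n)} {s₀ : Memory} (hn0 : 0 < n)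
    (hn : s₀.reg 22 = n) (h20 : s₀.reg 20 = 0) (h21 : s₀.reg 21 = 1)
    (h23 : s₀.reg 23 = c.toNat) (h : AttrState G c T X D s₀) :
    Runs G I J .attrStep s₀ (G.m₂ * 66) fun s' => SameAbove 11 s₀ s' ∧
      (∀ k, k = 0 ∨ k = 5 → s'.arr k = s₀.arr k) ∧
      ((G.pre c T X D ⊆ D ∧ AttrState G c T X D s') ∨
        ∃ j ∈ G.pre c T X D, j ∉ D ∧ AttrState G c T X (insert j D) s') := by
  have hm := G.le_m₂
  refine Runs.mono (Runs.seq (Runs.pick hn0 hn h20 h21 h.attr h.done) fun s₁ hs₁ => ?_)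
    (T := n * 9 + 1 + (1 + ((G.m₂ * 15 + 3) + (G.m₂ * 34 + 3)))) (by omega) fun _ h => h
  obtain ⟨hsame₁, harr₁, hj⟩ := hs₁
  have e21 : s₁.reg 21 = 1 := (hsame₁ 21 (by norm_num)).trans h21
  -- The set `D'` covers both outcomes of the search, so that the rest of the run is analysed once.
  obtain ⟨D', hcase, hdone, hits'⟩ : ∃ D' : Finset (Fin n),
      ((G.pre c T X D ⊆ D ∧ D' = D) ∨ ∃ j ∈ G.pre c T X D, j ∉ D ∧ D' = insert j D) ∧
      CodesSet (Function.update (s₁.arr 2) (s₁.reg 10) 1) D' ∧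
      ∀ τ, (G.Hits T D τ ∨ ∃ j : Fin n, (j : ℕ) = s₁.reg 10 ∧
        0 < G.prob τ.1 τ.2.1 τ.2.2 j) ↔ G.Hits T D' τ := by
    rcases hj with ⟨j, hj, hjY, hjD⟩ | ⟨hj, hYD⟩
    · refine ⟨insert j D, Or.inr ⟨j, hjY, hjD, rfl⟩, fun i => ?_, fun τ => ?_⟩
      · rw [hj, Function.update_apply, harr₁]
        by_cases hij : i = j
        · subst hij
          simpa using codes_one (Finset.mem_insert_self i D)
        · have hne : (i : ℕ) ≠ j := fun h => hij (Fin.ext h)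
          rw [if_neg hne]
          exact (h.done i).congr (by simp [hij])
      · simp only [Game.Hits, hj, Finset.exists_mem_insert, Fin.val_inj, exists_eq_left]
        exact or_assoc.trans (or_congr_right or_comm)
    -- Register `10` is `n` here: the write falls outside the cells that code states and no triple
    -- is marked, so an idle round is harmless.
    · refine ⟨D, Or.inl ⟨hYD, rfl⟩, fun i => ?_, fun τ => ?_⟩
      · rw [hj, Function.update_apply, harr₁, if_neg i.2.ne]
        exact h.done i
      · refine or_iff_left ?_
        rintro ⟨i, hi, _⟩
        exact i.2.ne (hi.trans hj)
  refine Runs.seq (T := 1) (Q := fun s => SameAbove 11 s₀ s ∧ s.reg 10 = s₁.reg 10 ∧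
    s.arr 2 = Function.update (s₁.arr 2) (s₁.reg 10) 1 ∧ ∀ k, k ≠ 2 → s.arr k = s₀.arr k)
    (Runs.of_wp ⟨hsame₁.setArr _ _ _, rfl, by simp [e21], fun k hk => by simp [hk, harr₁]⟩
      le_rfl) fun s₂ hs₂ => ?_
  obtain ⟨hsame₂, h10, hdone₂, hother₂⟩ := hs₂
  have f20 : s₂.reg 20 = 0 := (hsame₂ 20 (by norm_num)).trans h20
  have f21 : s₂.reg 21 = 1 := (hsame₂ 21 (by norm_num)).trans h21
  have f22 : s₂.reg 22 = n := (hsame₂ 22 (by norm_num)).trans hn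
  have f23 : s₂.reg 23 = c.toNat := (hsame₂ 23 (by norm_num)).trans h23
  refine Runs.seq (Runs.mark 3 f22 f21 (R := G.Hits T D)
    (by rw [hother₂ 3 (by norm_num)]; exact h.hits)) fun s₃ hs₃ => ?_
  obtain ⟨hsame₃, hother₃, hcodes₃⟩ := hs₃
  have hhits : G.CodesTriples (s₃.arr 3) (G.Hits T D') := fun τ =>
    (hcodes₃ τ).congr (by rw [h10]; exact hits' τ)
  have hleaves : G.CodesTriples (s₃.arr 4) (G.Leaves X) := by
    rw [hother₃ 4 (by norm_num), hother₂ 4 (by norm_num)]; exact h.leaves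
  refine (Runs.update (c := c) ((hsame₃ 22 (by norm_num)).trans f22)
    ((hsame₃ 20 (by norm_num)).trans f20) ((hsame₃ 21 (by norm_num)).trans f21)
    ((hsame₃ 23 (by norm_num)).trans f23) hhits hleaves (X := G.pre c T X D')
    fun i => Game.mem_pre).mono le_rfl ?_
  rintro s₄ ⟨hsame₄, hother₄, hattr⟩
  have hstate : AttrState G c T X D' s₄ :=
    { done := by
        rw [hother₄ 2 (by norm_num), hother₃ 2 (by norm_num), hdone₂]; exact hdone
      hits := by rw [hother₄ 3 (by norm_num)]; exact hhits
      leaves := by rw [hother₄ 4 (by norm_num)]; exact hleaves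
      attr := hattr }
  refine ⟨(hsame₂.trans (hsame₃.weaken (by norm_num))).trans (hsame₄.weaken (by norm_num)),
    fun k hk => ?_, ?_⟩
  · rw [hother₄ k (by omega), hother₃ k (by omega), hother₂ k (by omega)]
  · rcases hcase with ⟨hle, rfl⟩ | ⟨j, hj, hjD, rfl⟩
    · exact Or.inl ⟨hle, hstate⟩
    · exact Or.inr ⟨j, hj, hjD, hstate⟩

/-- The processed set `D` lies in its own predecessor set and in every closed set; each round adds a
state unless `D` is already closed. After `n` rounds `D` is closed, if only because it contains all
states, and so it is the attractor. -/
theorem Runs.attr {c : Bool} {T X : Finset (Fin n)} {s₀ : Memory} (hn0 : 0 < n)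
    (hn : s₀.reg 22 = n) (h20 : s₀.reg 20 = 0) (h21 : s₀.reg 21 = 1)
    (h23 : s₀.reg 23 = c.toNat) (h : AttrState G c T X ∅ s₀) :
    Runs G I J (.forLoop 11 22 .attrStep) s₀ (n * (G.m₂ * 66 + 4)) fun s' =>
      SameAbove 12 s₀ s' ∧ (∀ k, k = 0 ∨ k = 5 → s'.arr k = s₀.arr k) ∧
      ∃ Y, IsAttr (G.pre c T X) Y ∧ CodesSet (s'.arr 1) Y := by
  have hmono : Monotone (G.pre c T X) := fun _ _ h => G.pre_mono _ _ subset_rfl h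
  refine (Runs.forLoop (L := n) (Inv := fun q s => SameAbove 12 s₀ s ∧
    (∀ k, k = 0 ∨ k = 5 → s.arr k = s₀.arr k) ∧ ∃ D, AttrState G c T X D s ∧
      D ⊆ G.pre c T X D ∧ (∀ Z, G.pre c T X Z ⊆ Z → D ⊆ Z) ∧
      (G.pre c T X D ⊆ D ∨ q ≤ D.card))
    (T := fun _ => G.m₂ * 66) (by norm_num) hn ?_ ?_
    (sum_const_add_two_le _ _ hn0)).mono le_rfl ?_
  · exact ⟨(SameAbove.refl 12 s₀).setReg (by norm_num) _, fun _ _ => rfl, ∅,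
      ⟨h.done, h.hits, h.leaves, h.attr⟩, Finset.empty_subset _,
      fun _ _ => Finset.empty_subset _, Or.inr (Nat.zero_le _)⟩
  · intro q hq s h11 h22 ⟨hsame, hother, D, hD, hsub, hleast, hcard⟩
    refine (Runs.attrStep hn0 h22 ((hsame 20 (by norm_num)).trans h20)
      ((hsame 21 (by norm_num)).trans h21) ((hsame 23 (by norm_num)).trans h23) hD).mono
      le_rfl ?_
    rintro s' ⟨hsame', hother', hcase⟩
    refine ⟨by rw [hsame' 11 le_rfl, h11], by rw [hsame' 22 (by norm_num), h22],
      (hsame.trans (hsame'.weaken (by norm_num))).setReg (by norm_num) _,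
      fun k hk => (hother' k hk).trans (hother k hk), ?_⟩
    rcases hcase with ⟨hle, hs⟩ | ⟨j, hj, hjD, hs⟩
    · exact ⟨D, ⟨hs.done, hs.hits, hs.leaves, hs.attr⟩, hsub, hleast, Or.inl hle⟩
    · refine ⟨insert j D, ⟨hs.done, hs.hits, hs.leaves, hs.attr⟩, ?_, fun Z hZ => ?_, Or.inr ?_⟩
      · exact (Finset.insert_subset hj hsub).trans (hmono (Finset.subset_insert _ _))
      · exact Finset.insert_subset (hZ (hmono (hleast Z hZ) hj)) (hleast Z hZ)
      · rw [Finset.card_insert_of_notMem hjD]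
        rcases hcard with hcard | hcard
        · exact absurd (hcard hj) hjD
        · omega
  · rintro s' ⟨hsame, hother, D, hD, hsub, hleast, hcard⟩
    have hle : G.pre c T X D ⊆ D := by
      refine hcard.elim id fun hcard => ?_
      have : D = Finset.univ := Finset.eq_univ_of_card D
        ((Finset.card_le_univ D).antisymm (by simpa using hcard))
      rw [this]; exact Finset.subset_univ _
    refine ⟨hsame, hother, D, ⟨hle, hleast⟩, ?_⟩
    have := hD.attr
    rwa [hle.antisymm hsub] at this

theorem Runs.coreStep {c : Bool} {T X : Finset (Fin n)} {s₀ : Memory} (hn0 : 0 < n)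
    (hn : s₀.reg 22 = n) (h20 : s₀.reg 20 = 0) (h21 : s₀.reg 21 = 1)
    (h23 : s₀.reg 23 = c.toNat) (hX : CodesSet (s₀.arr 0) X) (hT : CodesSet (s₀.arr 5) T) :
    Runs G I J .coreStep s₀ (n * G.m₂ * 165) fun s' => SameAbove 12 s₀ s' ∧
      s'.arr 5 = s₀.arr 5 ∧ ∃ Y, IsAttr (G.pre c T X) Y ∧ CodesSet (s'.arr 0) Y := by
  have hm := G.le_m₂
  have htime : n * (1 + 4) + ((G.m₂ * 16 + 3) + (n * (G.m₂ * 15 + 9) + ((G.m₂ * 34 + 3) +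
      (n * (G.m₂ * 66 + 4) + n * (2 + 4))))) ≤ n * G.m₂ * 165 := by
    have h1 : n ≤ n * G.m₂ := Nat.le_mul_of_pos_right n (by omega)
    have h2 : G.m₂ ≤ n * G.m₂ := Nat.le_mul_of_pos_left _ hn0
    have h3 : n * (G.m₂ * 15 + 9) = n * G.m₂ * 15 + n * 9 := by ring
    have h4 : n * (G.m₂ * 66 + 4) = n * G.m₂ * 66 + n * 4 := by ring
    omega
  refine Runs.mono (Runs.seq (Runs.fill (T := 1) (k := 2) (S := ∅) hn0 hn ?_)
    fun s₁ hs₁ => ?_) htime fun _ h => h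
  · intro i s h7 hsame _
    refine Runs.of_wp ⟨⟨0, codes_zero (Finset.notMem_empty i), ?_⟩, fun k hk => ?_, ?_⟩ le_rfl
    · simp [h7, hsame 20, h20]
    · simp [hk]
    · exact (SameAbove.refl 1 s).setArr _ _ _
  obtain ⟨hsame₁, hother₁, hdone₁⟩ := hs₁
  refine Runs.seq (Runs.initTriples ((hsame₁ 22 (by norm_num)).trans hn)
    ((hsame₁ 20 (by norm_num)).trans h20) (by rw [hother₁ 5 (by norm_num)]; exact hT))
    fun s₂ hs₂ => ?_
  obtain ⟨hsame₂, hother₂, hhits₂, hleaves₂⟩ := hs₂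
  replace hsame₂ := hsame₁.trans hsame₂
  refine Runs.seq (Runs.markOutside hn0 ((hsame₂ 22 (by norm_num)).trans hn)
    ((hsame₂ 20 (by norm_num)).trans h20) ((hsame₂ 21 (by norm_num)).trans h21) (X := X)
    (by rw [hother₂ 0 (by norm_num) (by norm_num), hother₁ 0 (by norm_num)]; exact hX)
    hleaves₂) fun s₃ hs₃ => ?_
  obtain ⟨hsame₃, hother₃, hleaves₃⟩ := hs₃
  replace hsame₃ := (hsame₂.weaken (by norm_num)).trans hsame₃
  have hhits₃ : G.CodesTriples (s₃.arr 3) (G.Hits T ∅) := fun τ => by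
    rw [hother₃ 3 (by norm_num)]
    exact (hhits₂ τ).congr (by simp [Game.Hits])
  refine Runs.seq (Runs.update (c := c) ((hsame₃ 22 (by norm_num)).trans hn)
    ((hsame₃ 20 (by norm_num)).trans h20) ((hsame₃ 21 (by norm_num)).trans h21)
    ((hsame₃ 23 (by norm_num)).trans h23) hhits₃ hleaves₃ (X := G.pre c T X ∅)
    fun i => Game.mem_pre) fun s₄ hs₄ => ?_
  obtain ⟨hsame₄, hother₄, hattr₄⟩ := hs₄
  replace hsame₄ := hsame₃.trans (hsame₄.weaken (by norm_num))
  have hstate : AttrState G c T X ∅ s₄ :=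
    { done := by
        rw [hother₄ 2 (by norm_num), hother₃ 2 (by norm_num),
          hother₂ 2 (by norm_num) (by norm_num)]
        exact hdone₁
      hits := by rw [hother₄ 3 (by norm_num)]; exact hhits₃
      leaves := by rw [hother₄ 4 (by norm_num)]; exact hleaves₃
      attr := hattr₄ }
  refine Runs.seq (Runs.attr hn0 ((hsame₄ 22 (by norm_num)).trans hn)
    ((hsame₄ 20 (by norm_num)).trans h20) ((hsame₄ 21 (by norm_num)).trans h21)
    ((hsame₄ 23 (by norm_num)).trans h23) hstate) fun s₅ hs₅ => ?_
  obtain ⟨hsame₅, hother₅, Y, hY, hattr₅⟩ := hs₅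
  replace hsame₅ := (hsame₄.weaken (by norm_num)).trans hsame₅
  refine (Runs.fill (T := 2) (k := 0) (S := Y) hn0 ((hsame₅ 22 (by norm_num)).trans hn)
    ?_).mono le_rfl ?_
  · intro i s h7 hsame hother
    refine Runs.of_wp ⟨⟨_, hattr₅ i, ?_⟩, fun k hk => ?_, ?_⟩ le_rfl
    · simp [h7, hother 1]
    · simp [hk]
    · exact ((SameAbove.refl 1 s).setReg (by norm_num) _).setArr _ _ _
  · rintro s₆ ⟨hsame₆, hother₆, hattr₆⟩
    refine ⟨hsame₅.trans (hsame₆.weaken (by norm_num)), ?_, Y, hY, hattr₆⟩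
    rw [hother₆ 5 (by norm_num), hother₅ 5 (by simp), hother₄ 5 (by norm_num),
      hother₃ 5 (by norm_num), hother₂ 5 (by norm_num) (by norm_num), hother₁ 5 (by norm_num)]

/-- Iterating the attractor map downwards from the full set keeps the current set above every `Z`
contained in its own attractor. Each round either finds the set stationary or loses a state, so `n`
rounds suffice. -/
theorem Runs.core {c : Bool} {T : Finset (Fin n)} {s₀ : Memory} (hn0 : 0 < n)
    (hn : s₀.reg 22 = n) (h20 : s₀.reg 20 = 0) (h21 : s₀.reg 21 = 1)
    (h23 : s₀.reg 23 = c.toNat) (hX : CodesSet (s₀.arr 0) (Finset.univ : Finset (Fin n)))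
    (hT : CodesSet (s₀.arr 5) T) :
    Runs G I J (.forLoop 12 22 .coreStep) s₀ (n * (n * G.m₂ * 165 + 4)) fun s' =>
      SameAbove 13 s₀ s' ∧ s'.arr 5 = s₀.arr 5 ∧
      ∃ X, IsCore (G.pre c T) X ∧ CodesSet (s'.arr 0) X := by
  have hmono : ∀ X, Monotone (G.pre c T X) := fun X _ _ h => G.pre_mono _ _ subset_rfl h
  have hattr : ∀ {X X' Y Y'}, X ⊆ X' → IsAttr (G.pre c T X) Y → IsAttr (G.pre c T X') Y' →
      Y ⊆ Y' := fun hXX hY hY' => hY.2 _ ((G.pre_mono _ _ hXX subset_rfl).trans hY'.1)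
  refine (Runs.forLoop (L := n) (Inv := fun r s => SameAbove 13 s₀ s ∧
    s.arr 5 = s₀.arr 5 ∧ ∃ X, CodesSet (s.arr 0) X ∧
      (∀ Z Y, IsAttr (G.pre c T Z) Y → Z ⊆ Y → Z ⊆ X) ∧
      (∀ Y, IsAttr (G.pre c T X) Y → Y ⊆ X) ∧ (IsAttr (G.pre c T X) X ∨ X.card + r ≤ n))
    (T := fun _ => n * G.m₂ * 165) (by norm_num) hn ?_ ?_
    (sum_const_add_two_le _ _ hn0)).mono le_rfl ?_
  · exact ⟨(SameAbove.refl 13 s₀).setReg (by norm_num) _, rfl, Finset.univ, hX,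
      fun _ _ _ _ => Finset.subset_univ _, fun _ _ => Finset.subset_univ _, Or.inr (by simp)⟩
  · intro r hr s h12 h22 ⟨hsame, h5, X, hX, hgreat, hsub, hcard⟩
    refine (Runs.coreStep (c := c) (T := T) hn0 h22 ((hsame 20 (by norm_num)).trans h20)
      ((hsame 21 (by norm_num)).trans h21) ((hsame 23 (by norm_num)).trans h23) hX
      (by rw [h5]; exact hT)).mono le_rfl ?_
    rintro s' ⟨hsame', h5', Y, hY, hcodes⟩
    have hYX := hsub Y hY
    refine ⟨by rw [hsame' 12 le_rfl, h12], by rw [hsame' 22 (by norm_num), h22],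
      (hsame.trans (hsame'.weaken (by norm_num))).setReg (by norm_num) _, h5'.trans h5, Y,
      hcodes, fun Z W hW hZW => hZW.trans (hattr (hgreat Z W hW hZW) hW hY),
      fun W hW => hattr hYX hW hY, ?_⟩
    by_cases hne : Y = X
    · left
      have h := hY
      rw [← hne] at h
      exact h
    · right
      have hlt := Finset.card_lt_card (Finset.ssubset_iff_subset_ne.2 ⟨hYX, hne⟩)
      rcases hcard with hcard | hcard
      · exact absurd (hY.unique hcard) hne
      · omega
  · rintro s' ⟨hsame, h5, X, hX, hgreat, hsub, hcard⟩
    refine ⟨hsame, h5, X, ⟨hcard.elim id fun hcard => ?_, hgreat⟩, hX⟩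
    -- If every round lost a state, nothing is left, and the empty set is stationary because its
    -- attractor is contained in it.
    have hempty : X = ∅ := Finset.card_eq_zero.1 (by omega)
    obtain ⟨Y, hY⟩ := exists_isAttr (hmono X)
    have h1 := hsub Y hY
    rw [hempty, Finset.subset_empty] at h1
    rw [h1, ← hempty] at hY
    exact hY

/-- The core is unique, so the target is the core exactly when it agrees with the computed set state
by state. Register `24` is only ever lowered, which makes two successive checks a conjunction. -/
theorem Runs.checkCore {c : Bool} {t : Test} {T : Finset (Fin n)} {P : Prop} {s₀ : Memory}
    (hn0 : 0 < n) (hn : s₀.reg 22 = n) (h20 : s₀.reg 20 = 0) (h21 : s₀.reg 21 = 1)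
    (h23 : s₀.reg 23 = c.toNat) (h24 : Codes (s₀.reg 24) P)
    (ht : ∀ (i : Fin n) (s : Memory), s.reg 7 = i → (t.Holds G I J s ↔ i ∈ T)) :
    Runs G I J (.checkCore t) s₀ (n ^ 2 * G.m₂ * 188) fun s' =>
      (∀ r, 20 ≤ r → r ≠ 24 → s'.reg r = s₀.reg r) ∧
      Codes (s'.reg 24) (P ∧ IsCore (G.pre c T) T) := by
  have hm := G.le_m₂
  have htime : n * (2 + 4) + (n * (1 + 4) + (n * (n * G.m₂ * 165 + 4) + n * (4 + 4))) ≤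
      n ^ 2 * G.m₂ * 188 := by
    have h1 : n ≤ n * (n * G.m₂) :=
      Nat.le_mul_of_pos_right n (Nat.mul_pos hn0 (by omega))
    have h2 : n ^ 2 * G.m₂ = n * (n * G.m₂) := by ring
    have h3 : n * (n * G.m₂ * 165 + 4) = n * (n * G.m₂) * 165 + n * 4 := by ring
    omega
  refine Runs.mono (Runs.seq (Runs.fill (T := 2) (k := 5) (S := T) hn0 hn ?_)
    fun s₁ hs₁ => ?_) htime fun _ h => h
  · intro i s h7 hsame _
    refine Runs.of_wp ⟨fun h => ⟨⟨1, codes_one ((ht i s h7).1 h), ?_⟩, fun k hk => ?_, ?_⟩,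
      fun h => ⟨⟨0, codes_zero fun hi => h ((ht i s h7).2 hi), ?_⟩, fun k hk => ?_, ?_⟩⟩
      (by simp [Prog.cost])
    · simp [h7, hsame 21, h21]
    · simp [hk]
    · exact (SameAbove.refl 1 s).setArr _ _ _
    · simp [h7, hsame 20, h20]
    · simp [hk]
    · exact (SameAbove.refl 1 s).setArr _ _ _
  obtain ⟨hsame₁, -, hT₁⟩ := hs₁
  refine Runs.seq (Runs.fill (T := 1) (k := 0) (S := Finset.univ) hn0
    ((hsame₁ 22 (by norm_num)).trans hn) ?_) fun s₂ hs₂ => ?_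
  · intro i s h7 hsame _
    refine Runs.of_wp ⟨⟨1, codes_one (Finset.mem_univ i), ?_⟩, fun k hk => ?_, ?_⟩ le_rfl
    · simp [h7, hsame 21, hsame₁ 21, h21]
    · simp [hk]
    · exact (SameAbove.refl 1 s).setArr _ _ _
  obtain ⟨hsame₂, hother₂, hX₂⟩ := hs₂
  replace hsame₂ := hsame₁.trans hsame₂
  refine Runs.seq (Runs.core (c := c) hn0 ((hsame₂ 22 (by norm_num)).trans hn)
    ((hsame₂ 20 (by norm_num)).trans h20) ((hsame₂ 21 (by norm_num)).trans h21)
    ((hsame₂ 23 (by norm_num)).trans h23) hX₂ (by rw [hother₂ 5 (by norm_num)]; exact hT₁))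
    fun s₃ hs₃ => ?_
  obtain ⟨hsame₃, h5, X, hcore, hX⟩ := hs₃
  replace hsame₃ := (hsame₂.weaken (by norm_num)).trans hsame₃
  rw [hother₂ 5 (by norm_num)] at h5
  rw [← h5] at hT₁
  refine (Runs.forLoop (L := n) (Inv := fun i s =>
    (∀ r, 20 ≤ r → r ≠ 24 → s.reg r = s₀.reg r) ∧ s.arr = s₃.arr ∧
    Codes (s.reg 24) (P ∧ ∀ j : Fin n, (j : ℕ) < i → (j ∈ X ↔ j ∈ T)))
    (T := fun _ => 4) (by norm_num) ((hsame₃ 22 (by norm_num)).trans hn) ?_ ?_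
    (sum_const_add_two_le _ _ hn0)).mono le_rfl ?_
  · refine ⟨fun r hr _ => ?_, rfl, ?_⟩
    · rw [Memory.setReg_reg, if_neg (by omega)]; exact hsame₃ r (by omega)
    · simp only [Memory.setReg_reg]
      rw [if_neg (by norm_num), hsame₃ 24 (by norm_num)]
      exact h24.congr (by simp)
  · intro iv hi s h7 h22 ⟨hsame, harr, hcodes⟩
    obtain ⟨i, rfl⟩ : ∃ i : Fin n, (i : ℕ) = iv := ⟨⟨iv, hi⟩, rfl⟩
    have step : (∀ j : Fin n, (j : ℕ) < i + 1 → (j ∈ X ↔ j ∈ T)) ↔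
        (∀ j : Fin n, (j : ℕ) < i → (j ∈ X ↔ j ∈ T)) ∧ (i ∈ X ↔ i ∈ T) := by
      refine ⟨fun h => ⟨fun j hj => h j (by omega), h i (by omega)⟩, fun h j hj => ?_⟩
      rcases Nat.lt_succ_iff_lt_or_eq.1 hj with hj | hj
      · exact h.1 j hj
      · obtain rfl : j = i := Fin.ext hj
        exact h.2
    have htest : s₃.arr 0 i = s₃.arr 5 i ↔ (i ∈ X ↔ i ∈ T) := by
      rcases hX i with ⟨h, e⟩ | ⟨h, e⟩ <;> rcases hT₁ i with ⟨h', e'⟩ | ⟨h', e'⟩ <;>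
        simp [h, e, h', e']
    refine Runs.of_wp ?_ (by simp [Prog.cost])
    simp only [Prog.wp, Test.Holds]
    refine ⟨fun h => ⟨by simp [h7], by simp [h22], fun r hr hr' => ?_, harr, ?_⟩,
      fun h => ⟨by simp [h7], by simp [h22], fun r hr hr' => ?_, harr, ?_⟩⟩
    · simp only [Memory.setReg_reg]
      rw [if_neg (by omega), if_neg (by omega), if_neg (by omega)]; exact hsame r hr hr'
    · simp [h7, harr, htest] at h
      rw [step]
      simpa [h] using hcodes
    · simp only [Memory.setReg_reg]
      rw [if_neg (by omega), if_neg (by omega), if_neg (by omega), if_neg (by omega)]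
      exact hsame r hr hr'
    · simp [h7, harr, htest] at h
      rw [step]
      simpa [hsame 20, h20] using codes_zero fun h' => h h'.2.2
  · rintro s' ⟨hsame, -, hcodes⟩
    refine ⟨hsame, hcodes.congr (and_congr_right fun _ => ⟨fun h => ?_, fun h j _ => ?_⟩)⟩
    · have : X = T := Finset.ext fun j => h j j.2
      rwa [this] at hcore
    · rw [hcore.unique h]

end Core

/-- The program deciding whether there is a fixed point with prescribed argmin and argmax. -/
def Prog.decideIMinJMax : Prog :=
  .seq (.seq (.const 21 1) (.seq (.readN 22) (.seq (.const 24 1) (.const 23 1))))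
    (.seq (.checkCore (.memI 7)) (.seq (.const 23 0) (.seq (.checkCore (.memJ 7)) (.copy 0 24))))

/-- The two checks cost `188` units each, and the six remaining steps are absorbed since `n ^ 2 *
m₂` is positive: `382 = 2 * 188 + 6`. Register `20` needs no initialization because the memory
starts blank. -/
theorem Prog.decideIMinJMax_answersWithin {n : ℕ} (G : Game n) {I J : Finset (Fin n)}
    (hI : I.Nonempty) (hJ : J.Nonempty) (hIJ : Disjoint I J) :
    Prog.decideIMinJMax.AnswersWithin G I J (IMinJMax G.shapley I J)
      (382 * (n ^ 2 * G.m₂)) := by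
  obtain ⟨i₀, -⟩ := id hI
  have hn0 : 0 < n := i₀.pos
  have hpos : 0 < n ^ 2 * G.m₂ := Nat.mul_pos (pow_pos hn0 2) (hn0.trans_le G.le_m₂)
  have key : Runs G I J .decideIMinJMax Memory.blank
      (4 + (n ^ 2 * G.m₂ * 188 + (1 + (n ^ 2 * G.m₂ * 188 + 1)))) fun s =>
        Codes (s.reg 0) (IMinJMax G.shapley I J) := by
    refine Runs.seq (Q := fun s => s.reg 20 = 0 ∧ s.reg 21 = 1 ∧ s.reg 22 = n ∧ s.reg 23 = 1 ∧
      s.reg 24 = 1) (Runs.of_wp ?_ le_rfl) fun s₁ hs₁ => ?_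
    · simp [Prog.wp, Memory.blank]
    obtain ⟨h20, h21, h22, h23, h24⟩ := hs₁
    refine Runs.seq (Runs.checkCore (c := true) (T := I) hn0 h22 h20 h21 h23
      (h24 ▸ codes_one trivial) fun i s h7 => ?_) fun s₂ hs₂ => ?_
    · simp [Test.Holds, h7, Fin.val_inj]
    obtain ⟨hsame₂, h24⟩ := hs₂
    refine Runs.seq (Q := fun s => s.reg 20 = 0 ∧ s.reg 21 = 1 ∧ s.reg 22 = n ∧ s.reg 23 = 0 ∧
      s.reg 24 = s₂.reg 24) (Runs.of_wp ?_ le_rfl) fun s₃ hs₃ => ?_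
    · simp [Prog.wp, hsame₂, h20, h21, h22]
    obtain ⟨h20, h21, h22, h23, h24'⟩ := hs₃
    refine Runs.seq (Runs.checkCore (c := false) (T := J) hn0 h22 h20 h21 h23
      (h24' ▸ h24) fun i s h7 => ?_) fun s₄ hs₄ => Runs.of_wp ?_ le_rfl
    · simp [Test.Holds, h7, Fin.val_inj]
    simp only [Prog.wp, Memory.setReg_reg, if_true]
    refine hs₄.2.congr ?_
    rw [G.IMinJMax_iff hI hJ hIJ, G.IMin_iff_isCore hI, G.IMin_conjugate_iff_isCore hJ,
      true_and]
  obtain ⟨t, ht, s, he, hs⟩ := key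
  exact ⟨t, by omega, s, he, hs⟩

end PaymentFree

theorem corollary6p11 :
    -- one program, and one constant, for all inputs
    (∃ (p : PaymentFree.Prog) (C : ℕ),
      ∀ (n : ℕ) (G : PaymentFree.Game n) (I J : Finset (Fin n)),
        I.Nonempty → J.Nonempty → Disjoint I J →
          p.AnswersWithin G I J (PaymentFree.IMinJMax G.shapley I J) (C * (n ^ 2 * G.m₂))) ∧
    -- comparison of the two time bounds
    (∀ (n : ℕ) (G : PaymentFree.Game n), n ^ 2 * G.m₂ ≤ n ^ 3 * G.maxActions ^ 2) ∧
    -- the two instances: `F` with `I`, and the conjugate of `F`, which is again a payment-free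
    -- Shapley operator with finite action spaces, with `J`
    (∀ (n : ℕ) (G : PaymentFree.Game n) (I J : Finset (Fin n)),
      I.Nonempty → J.Nonempty → Disjoint I J →
        (∃ G' : PaymentFree.Game n, G'.shapley = PaymentFree.conjugate G.shapley) ∧
        (PaymentFree.IMinJMax G.shapley I J ↔
          PaymentFree.IMin G.shapley I ∧
            PaymentFree.IMin (PaymentFree.conjugate G.shapley) J)) :=
  ⟨⟨.decideIMinJMax, 382, fun _ G _ _ => PaymentFree.Prog.decideIMinJMax_answersWithin G⟩,
    fun _ G => G.sq_mul_m₂_le,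
    fun _ G _ _ hI hJ hIJ => ⟨⟨G.dual, G.dual_shapley⟩, G.IMinJMax_iff hI hJ hIJ⟩⟩
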